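/- **Setting.** For $x\in\mathbb R^d$ let $\mu(x)=\frac1d\sum_i x_i$, $\mathring x=x-\mu(x)(1,\dots,1)^\top$, $\|x\|_{-\infty}=\min_i|x_i|$; let $\mathcal N(x)_i=\mathring x_i/\sqrt{\tfrac1d\sum_j\mathring x_j^2}$ (layer normalization) and $\mathcal R(x)=\sqrt d\,x/\|x\|_2$ (RMS layer normalization). A configuration is $\Theta=(D,A_1,b_1,A_2,b_2,W_q,W_k,W_v)$ with $A_1\in\mathbb R^{D\times d}$, $b_1\in\mathbb R^D$, $A_2\in\mathbb R^{d\times D}$, $b_2\in\mathbb R^d$, $W_q,W_k,W_v\in\mathbb R^{d\times d}$. Put $\mathcal L_1(x)=A_1x+b_1$, $\mathcal M(x)=A_2\max\{0,\mathcal L_1(x)\}+b_2$ and, for $X=[x_1\cdots x_n]\in\mathbb R^{d\times n}$ with $X_t=[x_1\cdots x_t]$, let the $t$-th column of $\mathcal A(X)$ be $W_vX_t\psi_t(X)$, where $\psi_t(X)=\mathrm{softmax}\big(\tfrac1{\sqrt d}(W_kX_t)^\top W_qx_t\big)$. Functions of vectors are applied to matrices columnwise (written $^*$). For $\mathcal P\in\{\mathcal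 R,\mathcal N\}$ let $f_{\mathcal A}(X)=X+\mathcal A(\mathcal P^*(X))$, $f_{\mathcal M}(y)=y+\mathcal M(\mathcal P(y))$; the block is $f_{\mathcal M}^*\circ f_{\mathcal A}$, denoted $\mathcal Q_\Theta$ if $\mathcal P=\mathcal R$ and $\mathcal T_\Theta$ if $\mathcal P=\mathcal N$. For $\boldsymbol\Theta=(\Theta_1,\dots,\Theta_L)$ put $\mathcal Q_{\boldsymbol\Theta}=\mathcal Q_{\Theta_L}\circ\cdots\circ\mathcal Q_{\Theta_1}$, and likewise $\mathcal T_{\boldsymbol\Theta}$. **Error measure.** $\rho_c(\hat X,X)=\max_{i,t}|\hat x_{i,t}-x_{i,t}|/|x_{i,t}|$, with $0/0=0$ and $a/0=\infty$ for $a\ne0$ (also in the ratios below). With $\Omega=\{k:\mathcal L_1(x)_k>0\}$ let $$\xi(\mathcal A,X)=\max_{i,t}\frac{(|W_v||X_t|\psi_t(X))_i}{|\mathcal A(X)_{i,t}|},\qquad \xi(\mathcal M,x)=\max_i\frac{\sum_{k\in\Omega}|(A_2)_{i,k}|(|A_1||x|+|b_1|)_k+|(b_2)_i|}{|\mathcal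 M(x)_i|},$$ $$\xi(f_{\mathcal A},X)=\max_{i,t}\frac{|X_{i,t}|+|\mathcal A(\mathcal P^*(X))_{i,t}|}{|f_{\mathcal A}(X)_{i,t}|},\qquad \xi(f_{\mathcal M},y)=\max_i\frac{|y_i|+|\mathcal M(\mathcal P(y))_i|}{|f_{\mathcal M}(y)_i|},$$ $$K_\Theta=1+4\sqrt d\,\sigma_{\max}(|W_k|^\top|W_q|)\,\frac{\sigma_{\max}(W_k^\top W_q)}{\sigma_{\min}(W_k^\top W_q)}.$$ **Floating-point model.** There is a set $\mathbb F\subset\mathbb R$ of floating-point numbers, and the computed results of $+,-,\times,/$ (non-zero divisor), $\exp$ and $\sqrt{\cdot}$ (non-negative argument) on $\mathbb F$ lie in $\mathbb F$ and equal the exact result times $1+\delta$ with $|\delta|\le u$; the ReLU is exact. The input, all parameters and $d$ lie in $\mathbb F$, and $\sqrt d$ is represented by an element of $\mathbb F$ with relative error at most $u$. $\mathrm{fl}(\cdot)$ denotes the result of evaluating the network in this arithmetic from its formulas with recursive summation, $\mathcal N$ being evaluated as $\mathcal R$ applied to the computed $\mathring x$. Let $\gamma_d=du/(1-du)$. **Theorem.**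 Let $d\ge2$, let $\Theta_1,\dots,\Theta_L$ be configurations with the same $D$ and with $W_k^\top W_q$ non-singular in each, and let $X^{(0)}\in\mathbb R^{d\times n}$. The thresholds on $u$ and the constants in $O(u^2)$ below may depend on $d,n,D,L,\boldsymbol\Theta,X^{(0)}$, but not on $u$ or on the arithmetic. A vector or matrix is called generic if all its entries are non-zero. **1.** Let $\mathcal P=\mathcal R$, $X^{(l)}=(\mathcal Q_{\Theta_l}\circ\cdots\circ\mathcal Q_{\Theta_1})(X^{(0)})$ and $Y^{(l-1)}=f_{\mathcal A}(X^{(l-1)})$ with the parameters of layer $l$. For all sufficiently small $u>0$ the following holds. Suppose that for each $l=1,\dots,L$, with the parameters of layer $l$: the columns of $X^{(l-1)}$ and $Y^{(l-1)}$ are non-zero, $\mathcal A(\mathcal R^*(X^{(l-1)}))$ and every $\mathcal M(\mathcal R(y_t^{(l-1)}))$ are generic, and for every $t$ there is $\alpha\ge1$ such that, entrywise with $r=\mathcal R(y_t^{(l-1)})$, $|\mathcal L_1(r)|>\alpha\,(u+(1+u)\gamma_d)(|A_1||r|+|b_1|)$. Then $$\rho_c\big(\mathrm{fl}(\mathcal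 Q_{\boldsymbol\Theta}(X^{(0)})),\mathcal Q_{\boldsymbol\Theta}(X^{(0)})\big)\le\prod_{l=1}^L\big[\chi_lK_{\Theta_l}\big]\cdot\frac{9^L}{8}(6n+23d+D)\,u+O(u^2),$$ where $\chi_l=\max_t\{\xi(f_{\mathcal M},y_t^{(l-1)})\,\xi(\mathcal M,\mathcal R(y_t^{(l-1)}))\}\,\xi(f_{\mathcal A},X^{(l-1)})\,\xi(\mathcal A,\mathcal R^*(X^{(l-1)}))$ with the parameters of layer $l$. **2.** Let $\mathcal P=\mathcal N$, and define $X^{(l)}$, $Y^{(l-1)}$ in the same way with $\mathcal T$ in place of $\mathcal Q$. For all sufficiently small $u>0$ the following holds. Suppose that for each $l=1,\dots,L$, with the parameters of layer $l$: $\mathcal A(\mathcal N^*(X^{(l-1)}))$ and every $\mathcal M(\mathcal N(y_t^{(l-1)}))$ are generic; there is $\alpha\ge1$ with $\|\mathring x_t^{(l-1)}\|_{-\infty}>2\alpha(1+u)\gamma_d\|x_t^{(l-1)}\|_\infty$ for all $t$; and for every $t$ there is $\alpha\ge1$ such that $\|\mathring y_t^{(l-1)}\|_{-\infty}>2\alpha(1+u)\gamma_d\|y_t^{(l-1)}\|_\infty$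 and, entrywise with $r=\mathcal N(y_t^{(l-1)})$, $|\mathcal L_1(r)|>\alpha\,(u+(1+u)\gamma_d)(|A_1||r|+|b_1|)$. Then $$\rho_c\big(\mathrm{fl}(\mathcal T_{\boldsymbol\Theta}(X^{(0)})),\mathcal T_{\boldsymbol\Theta}(X^{(0)})\big)\le\prod_{l=1}^L\bigg[\eta_lK_{\Theta_l}\Big(1+\max_t\frac{\|x_t^{(l-1)}\|_\infty}{\|\mathring x_t^{(l-1)}\|_{-\infty}}\Big)\Big(1+\max_t\frac{\|y_t^{(l-1)}\|_\infty}{\|\mathring y_t^{(l-1)}\|_{-\infty}}\Big)\bigg]\cdot\frac{16^L}{15}(8n+34d+D)\,u+O(u^2),$$ where $\eta_l$ is given by the formula for $\chi_l$ with $\mathcal N$ in place of $\mathcal R$. -/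

import Mathlib

open scoped Matrix ENNReal

noncomputable section

namespace Transformer

/-! ## Exact transformers -/

/-- Parameters of one transformer block acting on tokens in `ℝ^d`, with hidden width `D`. -/
structure Config (d D : ℕ) where
  A₁ : Matrix (Fin D) (Fin d) ℝ
  b₁ : Fin D → ℝ
  A₂ : Matrix (Fin d) (Fin D) ℝ
  b₂ : Fin d → ℝ
  Wq : Matrix (Fin d) (Fin d) ℝ
  Wk : Matrix (Fin d) (Fin d) ℝ
  Wv : Matrix (Fin d) (Fin d) ℝ

variable {d D n m L : ℕ}

/-- Columnwise extension of a function on tokens to collections of tokens. -/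
def colMap (f : (Fin d → ℝ) → Fin d → ℝ) (X : Matrix (Fin d) (Fin n) ℝ) :
    Matrix (Fin d) (Fin n) ℝ :=
  Matrix.of fun i t => f (X.col t) i

/-- The submatrix of the columns `0, …, t`. -/
def firstCols (X : Matrix (Fin d) (Fin n) ℝ) (t : Fin n) :
    Matrix (Fin d) (Fin (t.val + 1)) ℝ :=
  X.submatrix id (Fin.castLE t.isLt)

/-- Sample mean. -/
def mean (x : Fin d → ℝ) : ℝ := (∑ i, x i) / d

/-- Sample variance (with the factor `1 / d`). -/
def variance (x : Fin d → ℝ) : ℝ := (∑ i, (x i - mean x) ^ 2) / d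

/-- Centring. -/
def centr (x : Fin d → ℝ) : Fin d → ℝ := fun i => x i - mean x

/-- Layer normalization. -/
def layerNorm (x : Fin d → ℝ) : Fin d → ℝ := fun i => (x i - mean x) / √(variance x)

/-- Root mean square layer normalization. -/
def rmsNorm (x : Fin d → ℝ) : Fin d → ℝ := fun i => √(d : ℝ) * (x i / ‖WithLp.toLp 2 x‖)

/-- The first affine map of the two-layer perceptron. -/
def affine₁ (Θ : Config d D) (x : Fin d → ℝ) : Fin D → ℝ := Θ.A₁ *ᵥ x + Θ.b₁

/-- The two-layer perceptron with ReLU activation. -/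
def mlp (Θ : Config d D) (x : Fin d → ℝ) : Fin d → ℝ :=
  Θ.A₂ *ᵥ (fun k => max 0 (affine₁ Θ x k)) + Θ.b₂

/-- Similarity scores of all columns against the last column. -/
def scores (Θ : Config d D) (X : Matrix (Fin d) (Fin (m + 1)) ℝ) : Fin (m + 1) → ℝ :=
  (1 / √(d : ℝ)) • ((Θ.Wk * X)ᵀ *ᵥ (Θ.Wq *ᵥ X.col (Fin.last m)))

def softmax (s : Fin m → ℝ) : Fin m → ℝ := fun j => Real.exp (s j) / ∑ i, Real.exp (s i)

/-- Causal single-head self-attention. -/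
def attn (Θ : Config d D) (X : Matrix (Fin d) (Fin n) ℝ) : Matrix (Fin d) (Fin n) ℝ :=
  Matrix.of fun i t =>
    (Θ.Wv *ᵥ (firstCols X t *ᵥ softmax (scores Θ (firstCols X t)))) i

/-- The self-attention sub-block, for a choice `N` of the normalization. -/
def attnBlock (N : (Fin d → ℝ) → Fin d → ℝ) (Θ : Config d D)
    (X : Matrix (Fin d) (Fin n) ℝ) : Matrix (Fin d) (Fin n) ℝ :=
  X + attn Θ (colMap N X)

/-- The transformer block, for a choice `N` of the normalization. -/
def block (N : (Fin d → ℝ) → Fin d → ℝ) (Θ : Config d D)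
    (X : Matrix (Fin d) (Fin n) ℝ) : Matrix (Fin d) (Fin n) ℝ :=
  attnBlock N Θ X + colMap (mlp Θ) (colMap N (attnBlock N Θ X))

/-- `deep step L Θ = step Θ_L ∘ ⋯ ∘ step Θ_1`. -/
def deep {C S : Type*} (step : C → S → S) : (L : ℕ) → (Fin L → C) → S → S
  | 0, _, x => x
  | L + 1, Θ, x => step (Θ (Fin.last L)) (deep step L (fun l => Θ l.castSucc) x)

/-- The input of layer `l` (layers counted from `0`), i.e. the output of the first `l` layers. -/
def layerInput {C S : Type*} (step : C → S → S) (Θ : Fin L → C) (x : S) (l : Fin L) : S :=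
  deep step l.val (fun k => Θ (Fin.castLE l.isLt.le k)) x

/-! ## Floating-point arithmetic -/

/-- Floating-point arithmetic with unit roundoff `u`: a set `F` of floating-point numbers and
rounded operations on it, each with relative error at most `u`. Nothing is required of the
operations outside `F`, of divisions by zero or of square roots of negative numbers. -/
structure FloatArith (u : ℝ) where
  F : Set ℝ
  fadd : ℝ → ℝ → ℝ
  fsub : ℝ → ℝ → ℝ
  fmul : ℝ → ℝ → ℝ
  fdiv : ℝ → ℝ → ℝ
  fexp : ℝ → ℝ
  fsqrt : ℝ → ℝ
  zero_mem : (0 : ℝ) ∈ F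
  fadd_mem : ∀ x ∈ F, ∀ y ∈ F, fadd x y ∈ F
  fsub_mem : ∀ x ∈ F, ∀ y ∈ F, fsub x y ∈ F
  fmul_mem : ∀ x ∈ F, ∀ y ∈ F, fmul x y ∈ F
  fdiv_mem : ∀ x ∈ F, ∀ y ∈ F, y ≠ 0 → fdiv x y ∈ F
  fexp_mem : ∀ x ∈ F, fexp x ∈ F
  fsqrt_mem : ∀ x ∈ F, 0 ≤ x → fsqrt x ∈ F
  fadd_err : ∀ x ∈ F, ∀ y ∈ F, ∃ δ : ℝ, |δ| ≤ u ∧ fadd x y = (x + y) * (1 + δ)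
  fsub_err : ∀ x ∈ F, ∀ y ∈ F, ∃ δ : ℝ, |δ| ≤ u ∧ fsub x y = (x - y) * (1 + δ)
  fmul_err : ∀ x ∈ F, ∀ y ∈ F, ∃ δ : ℝ, |δ| ≤ u ∧ fmul x y = (x * y) * (1 + δ)
  fdiv_err : ∀ x ∈ F, ∀ y ∈ F, y ≠ 0 → ∃ δ : ℝ, |δ| ≤ u ∧ fdiv x y = (x / y) * (1 + δ)
  fexp_err : ∀ x ∈ F, ∃ δ : ℝ, |δ| ≤ u ∧ fexp x = Real.exp x * (1 + δ)
  fsqrt_err : ∀ x ∈ F, 0 ≤ x → ∃ δ : ℝ, |δ| ≤ u ∧ fsqrt x = √x * (1 + δ)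

variable {u : ℝ}

/-- Recursive (left-to-right) summation. -/
def flSum (𝔸 : FloatArith u) : (m : ℕ) → (Fin m → ℝ) → ℝ
  | 0, _ => 0
  | 1, x => x 0
  | m + 2, x => 𝔸.fadd (flSum 𝔸 (m + 1) (fun i => x i.castSucc)) (x (Fin.last (m + 1)))

def flDot (𝔸 : FloatArith u) (x y : Fin m → ℝ) : ℝ :=
  flSum 𝔸 m fun i => 𝔸.fmul (x i) (y i)

def flMulVec (𝔸 : FloatArith u) {p : ℕ} (A : Matrix (Fin p) (Fin m) ℝ) (x : Fin m → ℝ) :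
    Fin p → ℝ :=
  fun i => flDot 𝔸 (A i) x

/-- Computed RMS layer normalization; `s` is the floating-point number standing for `√d`. -/
def flRmsNorm (𝔸 : FloatArith u) (s : ℝ) (x : Fin d → ℝ) : Fin d → ℝ :=
  fun i => 𝔸.fdiv (𝔸.fmul s (x i)) (𝔸.fsqrt (flDot 𝔸 x x))

def flCentr (𝔸 : FloatArith u) (x : Fin d → ℝ) : Fin d → ℝ :=
  fun i => 𝔸.fsub (x i) (𝔸.fdiv (flSum 𝔸 d x) d)

/-- Computed layer normalization: centring followed by RMS normalization. -/
def flLayerNorm (𝔸 : FloatArith u) (s : ℝ) (x : Fin d → ℝ) : Fin d → ℝ :=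
  flRmsNorm 𝔸 s (flCentr 𝔸 x)

def flAffine (𝔸 : FloatArith u) {p : ℕ} (A : Matrix (Fin p) (Fin m) ℝ) (b : Fin p → ℝ)
    (x : Fin m → ℝ) : Fin p → ℝ :=
  fun i => 𝔸.fadd (flMulVec 𝔸 A x i) (b i)

/-- Computed two-layer perceptron; the ReLU is exact. -/
def flMlp (𝔸 : FloatArith u) (Θ : Config d D) (x : Fin d → ℝ) : Fin d → ℝ :=
  flAffine 𝔸 Θ.A₂ Θ.b₂ fun k => max 0 (flAffine 𝔸 Θ.A₁ Θ.b₁ x k)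

def flScores (𝔸 : FloatArith u) (s : ℝ) (Θ : Config d D)
    (X : Matrix (Fin d) (Fin (m + 1)) ℝ) : Fin (m + 1) → ℝ :=
  fun i => 𝔸.fdiv
    (flDot 𝔸 (flMulVec 𝔸 Θ.Wk (X.col i)) (flMulVec 𝔸 Θ.Wq (X.col (Fin.last m)))) s

def flSoftmax (𝔸 : FloatArith u) (z : Fin m → ℝ) : Fin m → ℝ :=
  fun j => 𝔸.fdiv (𝔸.fexp (z j)) (flSum 𝔸 m fun i => 𝔸.fexp (z i))

def flAttn (𝔸 : FloatArith u) (s : ℝ) (Θ : Config d D) (X : Matrix (Fin d) (Fin n) ℝ) :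
    Matrix (Fin d) (Fin n) ℝ :=
  Matrix.of fun i t =>
    flMulVec 𝔸 Θ.Wv
      (flMulVec 𝔸 (firstCols X t) (flSoftmax 𝔸 (flScores 𝔸 s Θ (firstCols X t)))) i

def flMatAdd (𝔸 : FloatArith u) (X Y : Matrix (Fin d) (Fin n) ℝ) : Matrix (Fin d) (Fin n) ℝ :=
  Matrix.of fun i t => 𝔸.fadd (X i t) (Y i t)

def flAttnBlock (𝔸 : FloatArith u) (s : ℝ) (N : (Fin d → ℝ) → Fin d → ℝ) (Θ : Config d D)
    (X : Matrix (Fin d) (Fin n) ℝ) : Matrix (Fin d) (Fin n) ℝ :=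
  flMatAdd 𝔸 X (flAttn 𝔸 s Θ (colMap N X))

/-- Computed transformer block, for a computed normalization `N`. -/
def flBlock (𝔸 : FloatArith u) (s : ℝ) (N : (Fin d → ℝ) → Fin d → ℝ) (Θ : Config d D)
    (X : Matrix (Fin d) (Fin n) ℝ) : Matrix (Fin d) (Fin n) ℝ :=
  flMatAdd 𝔸 (flAttnBlock 𝔸 s N Θ X)
    (colMap (flMlp 𝔸 Θ) (colMap N (flAttnBlock 𝔸 s N Θ X)))

/-- All parameters are floating-point numbers. -/
def Config.IsFloat (Θ : Config d D) (𝔸 : FloatArith u) : Prop :=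
  (∀ k j, Θ.A₁ k j ∈ 𝔸.F) ∧ (∀ k, Θ.b₁ k ∈ 𝔸.F) ∧ (∀ i k, Θ.A₂ i k ∈ 𝔸.F) ∧
    (∀ i, Θ.b₂ i ∈ 𝔸.F) ∧ (∀ i j, Θ.Wq i j ∈ 𝔸.F) ∧ (∀ i j, Θ.Wk i j ∈ 𝔸.F) ∧
    (∀ i j, Θ.Wv i j ∈ 𝔸.F)

/-- The exact data of the computation are floating-point numbers: the input, the parameters and
the dimension `d`; and `√d` is represented by a floating-point number `s` with relative error at
most `u` (so it is `√d` itself if that is exact, or its computed value otherwise). -/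
def IsFloatData (𝔸 : FloatArith u) (s : ℝ) (Θ : Fin L → Config d D)
    (X : Matrix (Fin d) (Fin n) ℝ) : Prop :=
  (∀ i t, X i t ∈ 𝔸.F) ∧ (∀ l, (Θ l).IsFloat 𝔸) ∧ (d : ℝ) ∈ 𝔸.F ∧
    s ∈ 𝔸.F ∧ |s - √(d : ℝ)| ≤ u * √(d : ℝ)

/-! ## Error measure and the quantities of the bound

Ratios are taken in `ℝ≥0∞`, where `a / 0 = ∞` for `a ≠ 0` and `0 / 0 = 0`. -/

/-- `|a| / |b|`. -/
def absRatio (a b : ℝ) : ℝ≥0∞ := ENNReal.ofReal |a| / ENNReal.ofReal |b|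

/-- Componentwise relative distance of `Xhat` to `X`. -/
def relDist (Xhat X : Matrix (Fin d) (Fin n) ℝ) : ℝ≥0∞ :=
  ⨆ (i) (t), absRatio (Xhat i t - X i t) (X i t)

/-- `‖x‖_{-∞} = min_i |x_i|`. -/
def minAbs (x : Fin d → ℝ) : ℝ := ⨅ i, |x i|

/-- `max_t ‖x_t‖_∞ / ‖centr x_t‖_{-∞}`. -/
def centrRatio (X : Matrix (Fin d) (Fin n) ℝ) : ℝ≥0∞ :=
  ⨆ t, absRatio ‖X.col t‖ (minAbs (centr (X.col t)))

/-- `ξ` of the sum `x + z`: `max_i (|x_i| + |z_i|) / |x_i + z_i|`. -/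
def xiAdd (x z : Fin d → ℝ) : ℝ≥0∞ :=
  ⨆ i, absRatio (|x i| + |z i|) (x i + z i)

/-- `ξ(A, X)` of the self-attention. -/
def xiAttn (Θ : Config d D) (X : Matrix (Fin d) (Fin n) ℝ) : ℝ≥0∞ :=
  ⨆ (i) (t), absRatio
    (((Θ.Wv.map abs) *ᵥ (((firstCols X t).map abs) *ᵥ
      softmax (scores Θ (firstCols X t)))) i)
    (attn Θ X i t)

/-- `ξ(M, x)` of the two-layer perceptron; the sum is over the positive support of `affine₁ Θ x`. -/
def xiMlp (Θ : Config d D) (x : Fin d → ℝ) : ℝ≥0∞ :=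
  ⨆ i, absRatio
    (∑ k with 0 < affine₁ Θ x k, |Θ.A₂ i k| * (∑ j, |Θ.A₁ k j| * |x j| + |Θ.b₁ k|) + |Θ.b₂ i|)
    (mlp Θ x i)

/-- The amplification factor of a block with normalization `N` at `X`: with `Y` the output of the
self-attention sub-block,
`max_t {ξ(y ↦ y + M(N y), y_t) ξ(M, N y_t)} · ξ(X ↦ X + A(N* X), X) · ξ(A, N* X)`. -/
def blockXi (N : (Fin d → ℝ) → Fin d → ℝ) (Θ : Config d D) (X : Matrix (Fin d) (Fin n) ℝ) :
    ℝ≥0∞ :=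
  (⨆ t, xiAdd ((attnBlock N Θ X).col t) (mlp Θ (N ((attnBlock N Θ X).col t))) *
      xiMlp Θ (N ((attnBlock N Θ X).col t))) *
    (⨆ t, xiAdd (X.col t) ((attn Θ (colMap N X)).col t)) *
    xiAttn Θ (colMap N X)

/-- Largest singular value. -/
def sigmaMax (A : Matrix (Fin d) (Fin d) ℝ) : ℝ := (Matrix.toEuclideanLin A).singularValues 0

/-- Smallest singular value (of a `d × d` matrix with `d ≥ 1`). -/
def sigmaMin (A : Matrix (Fin d) (Fin d) ℝ) : ℝ :=
  (Matrix.toEuclideanLin A).singularValues (d - 1)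

/-- `1 + 4 √d σ_max(|W_k|ᵀ |W_q|) σ_max(W_kᵀ W_q) / σ_min(W_kᵀ W_q)`. -/
def keyQueryFactor (Θ : Config d D) : ℝ :=
  1 + 4 * √(d : ℝ) * sigmaMax ((Θ.Wk.map abs)ᵀ * Θ.Wq.map abs) *
    (sigmaMax (Θ.Wkᵀ * Θ.Wq) / sigmaMin (Θ.Wkᵀ * Θ.Wq))

/-! ## Genericity assumptions -/

/-- All entries are non-zero. -/
def Generic {ι : Type*} (x : ι → ℝ) : Prop := ∀ i, x i ≠ 0

/-- `γ_k = k u / (1 - k u)`. -/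
def gamma (u : ℝ) (k : ℕ) : ℝ := k * u / (1 - k * u)

/-- `|L₁(x)| > α (u + (1 + u) γ_d) (|A₁| |x| + |b₁|)` entrywise. -/
def AffineGeneric (u α : ℝ) (Θ : Config d D) (x : Fin d → ℝ) : Prop :=
  ∀ k, α * (u + (1 + u) * gamma u d) * (∑ j, |Θ.A₁ k j| * |x j| + |Θ.b₁ k|) < |affine₁ Θ x k|

/-- `‖centr x‖_{-∞} > 2 α (1 + u) γ_d ‖x‖_∞`. -/
def CentrGeneric (u α : ℝ) (x : Fin d → ℝ) : Prop :=
  α * 2 * (1 + u) * gamma u d * ‖x‖ < minAbs (centr x)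

/-- Assumptions on the input of a block with RMS layer normalization. The normalized columns are
non-zero (so that the normalization is defined), the outputs of self-attention and perceptron are
generic and the inputs of the ReLU are sufficiently generic. -/
def RmsAdmissible (u : ℝ) (Θ : Config d D) (X : Matrix (Fin d) (Fin n) ℝ) : Prop :=
  (∀ t, X.col t ≠ 0) ∧
  (∀ t, Generic ((attn Θ (colMap rmsNorm X)).col t)) ∧
  ∀ t, (attnBlock rmsNorm Θ X).col t ≠ 0 ∧
    Generic (mlp Θ (rmsNorm ((attnBlock rmsNorm Θ X).col t))) ∧
    ∃ α : ℝ, 1 ≤ α ∧ AffineGeneric u α Θ (rmsNorm ((attnBlock rmsNorm Θ X).col t))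

/-- Assumptions on the input of a block with layer normalization. -/
def LayerAdmissible (u : ℝ) (Θ : Config d D) (X : Matrix (Fin d) (Fin n) ℝ) : Prop :=
  (∀ t, Generic ((attn Θ (colMap layerNorm X)).col t)) ∧
  (∃ α : ℝ, 1 ≤ α ∧ ∀ t, CentrGeneric u α (X.col t)) ∧
  ∀ t, Generic (mlp Θ (layerNorm ((attnBlock layerNorm Θ X).col t))) ∧
    ∃ α : ℝ, 1 ≤ α ∧ CentrGeneric u α ((attnBlock layerNorm Θ X).col t) ∧
      AffineGeneric u α Θ (layerNorm ((attnBlock layerNorm Θ X).col t))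

end Transformer

end

open Transformer

/-! Errors are followed to first order along a filter on machines (unit roundoff, arithmetic, number
standing for `√d`) with `u → 0⁺`. `ErrBound` asserts an error of at most `(a + o(1)) u`. The filter
ranges over all arithmetics at once, so an eventual bound yields a threshold on `u` that does not
depend on the arithmetic (`exists_of_eventually_smallRoundoff`).

One block turns an entrywise relative error `ε` into `c (b ε + κ)` (`Approx.flBlock`). Sums with
possible cancellation are measured against the sum of the moduli of their terms, and `ξ` is the
ratio of this majorant to the result. In the attention the scores have a bounded absolute error,
because normalized columns have length `√d`. The exponential turns absolute into relative error, so
the softmax costs a factor `1 + 4√d σ_max(|W_k|ᵀ|W_q|)`. This is at most `keyQueryFactor`, since a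
condition number is at least 1. Centring costs `‖x‖_∞ / ‖centr x‖_{-∞}`.

Since `c ≥ 1` in every layer, composition (`Approx.deep`) gives `∏ c · κ · (1 + b + ⋯ + b^(L-1))`.
For `L ≥ 1` and finite factors this is strictly below `∏ c · κ · b^L / (b - 1)`, and the gap absorbs
the `o(1)` terms. Hence the final bound holds with no second-order term. The admissibility
conditions enter only through consequences free of `u`: certain exact quantities do not vanish. -/

namespace Transformer

/-! ### First-order error calculus -/

open Filter Topology

/-- Along `l`, the error of `f` as an approximation of `x` is at most `a * u` to first order. -/
def ErrBound {ι : Type*} (l : Filter ι) (u f : ι → ℝ) (x a : ℝ) : Prop :=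
  ∃ r : ι → ℝ, Tendsto r l (𝓝 0) ∧ ∀ᶠ i in l, |f i - x| ≤ (a + r i) * u i

namespace ErrBound

variable {ι : Type*} {l : Filter ι} {u f g : ι → ℝ} {x y a b : ℝ}

/-- Any strict slack in the constant absorbs the `o(1)` term. This is how second-order terms
disappear. -/
theorem eventually_le (h : ErrBound l u f x a) (hu : Tendsto u l (𝓝[>] 0)) (hb : a < b) :
    ∀ᶠ i in l, |f i - x| ≤ b * u i := by
  obtain ⟨r, hr, h⟩ := h
  filter_upwards [h, hr.eventually (gt_mem_nhds (sub_pos.2 hb)),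
    hu.eventually self_mem_nhdsWithin] with i hi hri hui
  exact hi.trans (mul_le_mul_of_nonneg_right (by linarith) (le_of_lt hui))

theorem tendsto (h : ErrBound l u f x a) (hu : Tendsto u l (𝓝[>] 0)) : Tendsto f l (𝓝 x) := by
  have hu0 : Tendsto u l (𝓝 0) := hu.mono_right nhdsWithin_le_nhds
  rw [tendsto_iff_norm_sub_tendsto_zero]
  refine squeeze_zero' (.of_forall fun _ => norm_nonneg _)
    (h.eventually_le hu (lt_add_one a)) ?_
  simpa using hu0.const_mul (a + 1)

theorem mono (h : ErrBound l u f x a) (hu : Tendsto u l (𝓝[>] 0)) (hab : a ≤ b) :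
    ErrBound l u f x b := by
  obtain ⟨r, hr, h⟩ := h
  refine ⟨r, hr, ?_⟩
  filter_upwards [h, hu.eventually self_mem_nhdsWithin] with i hi hui
  exact hi.trans (mul_le_mul_of_nonneg_right (by linarith) (le_of_lt hui))

theorem const (x : ℝ) : ErrBound l u (fun _ => x) x 0 :=
  ⟨fun _ => 0, tendsto_const_nhds, by simp⟩

theorem of_le (h : ∀ᶠ i in l, |f i - x| ≤ a * u i) : ErrBound l u f x a :=
  ⟨fun _ => 0, tendsto_const_nhds, by simpa using h⟩

theorem add (hf : ErrBound l u f x a) (hg : ErrBound l u g y b) :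
    ErrBound l u (fun i => f i + g i) (x + y) (a + b) := by
  obtain ⟨r, hr, hf⟩ := hf
  obtain ⟨r', hr', hg⟩ := hg
  refine ⟨fun i => r i + r' i, by simpa using hr.add hr', ?_⟩
  filter_upwards [hf, hg] with i h1 h2
  calc |f i + g i - (x + y)| = |(f i - x) + (g i - y)| := by ring_nf
    _ ≤ |f i - x| + |g i - y| := abs_add_le _ _
    _ ≤ _ := by linarith

theorem neg (hf : ErrBound l u f x a) : ErrBound l u (fun i => -f i) (-x) a := by
  obtain ⟨r, hr, hf⟩ := hf
  refine ⟨r, hr, ?_⟩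
  filter_upwards [hf] with i h
  rwa [show -f i - -x = -(f i - x) by ring, abs_neg]

theorem sub (hf : ErrBound l u f x a) (hg : ErrBound l u g y b) :
    ErrBound l u (fun i => f i - g i) (x - y) (a + b) := by
  simpa only [sub_eq_add_neg] using hf.add hg.neg

theorem mul (hf : ErrBound l u f x a) (hg : ErrBound l u g y b) (hu : Tendsto u l (𝓝[>] 0)) :
    ErrBound l u (fun i => f i * g i) (x * y) (|x| * b + |y| * a) := by
  have hfx := (hf.tendsto hu).abs
  obtain ⟨r, hr, hf⟩ := hf
  obtain ⟨r', hr', hg⟩ := hg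
  refine ⟨fun i => |f i| * (b + r' i) - |x| * b + |y| * r i, ?_, ?_⟩
  · simpa using ((hfx.mul (hr'.const_add b)).sub_const (|x| * b)).add (hr.const_mul |y|)
  filter_upwards [hf, hg] with i h1 h2
  calc |f i * g i - x * y| = |f i * (g i - y) + y * (f i - x)| := by ring_nf
    _ ≤ |f i| * |g i - y| + |y| * |f i - x| := by
      simpa only [abs_mul] using abs_add_le (f i * (g i - y)) (y * (f i - x))
    _ ≤ |f i| * ((b + r' i) * u i) + |y| * ((a + r i) * u i) := by gcongr
    _ = _ := by ring

/-- The difference quotient `dslope h x` is continuous at `x` with value `h'`, so differentiability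
at the single point `x` suffices. -/
theorem comp {h : ℝ → ℝ} {h' : ℝ} (hf : ErrBound l u f x a) (hh : HasDerivAt h h' x)
    (hu : Tendsto u l (𝓝[>] 0)) : ErrBound l u (fun i => h (f i)) (h x) (|h'| * a) := by
  have hd : Tendsto (fun i => |dslope h x (f i)|) l (𝓝 |h'|) := by
    have := (continuousAt_dslope_same.2 hh.differentiableAt).tendsto.comp (hf.tendsto hu)
    rw [dslope_same, hh.deriv] at this
    exact this.abs
  obtain ⟨r, hr, hf⟩ := hf
  refine ⟨fun i => |dslope h x (f i)| * (a + r i) - |h'| * a, ?_, ?_⟩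
  · simpa using (hd.mul (hr.const_add a)).sub_const (|h'| * a)
  filter_upwards [hf] with i h1
  rw [← sub_smul_dslope h x (f i), smul_eq_mul, abs_mul, mul_comm]
  calc |dslope h x (f i)| * |f i - x| ≤ |dslope h x (f i)| * ((a + r i) * u i) := by gcongr
    _ = _ := by ring

theorem round (hf : ErrBound l u f x a) (hu : Tendsto u l (𝓝[>] 0))
    (hg : ∀ᶠ i in l, ∃ δ : ℝ, |δ| ≤ u i ∧ g i = f i * (1 + δ)) :
    ErrBound l u g x (a + |x|) := by
  have hfx := (hf.tendsto hu).abs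
  obtain ⟨r, hr, hf⟩ := hf
  refine ⟨fun i => r i + (|f i| - |x|), by simpa using hr.add (hfx.sub_const |x|), ?_⟩
  filter_upwards [hf, hg] with i h1 ⟨δ, hδ, h2⟩
  calc |g i - x| = |(f i - x) + f i * δ| := by rw [h2]; ring_nf
    _ ≤ |f i - x| + |f i| * |δ| := by simpa only [abs_mul] using abs_add_le (f i - x) (f i * δ)
    _ ≤ (a + r i) * u i + |f i| * u i := by gcongr
    _ = _ := by ring

end ErrBound

/-! ### Rounding errors of elementary operations, sums and dot products -/

/-- Along `l`, `f` is computed in the arithmetics `A` and approximates `x` with error at most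
`a * u` to first order. -/
def Approx {ι : Type*} {u : ι → ℝ} (A : ∀ i, FloatArith (u i)) (l : Filter ι) (f : ι → ℝ)
    (x a : ℝ) : Prop :=
  (∀ᶠ i in l, f i ∈ (A i).F) ∧ ErrBound l u f x a

namespace Approx

variable {ι : Type*} {l : Filter ι} {u : ι → ℝ} {A : ∀ i, FloatArith (u i)} {f g : ι → ℝ}
  {x y a b : ℝ}

theorem tendsto (h : Approx A l f x a) (hu : Tendsto u l (𝓝[>] 0)) : Tendsto f l (𝓝 x) :=
  h.2.tendsto hu

theorem mono (h : Approx A l f x a) (hu : Tendsto u l (𝓝[>] 0)) (hab : a ≤ b) :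
    Approx A l f x b :=
  ⟨h.1, h.2.mono hu hab⟩

theorem const (h : ∀ᶠ i in l, x ∈ (A i).F) : Approx A l (fun _ => x) x 0 :=
  ⟨h, .const x⟩

theorem fadd (hf : Approx A l f x a) (hg : Approx A l g y b) (hu : Tendsto u l (𝓝[>] 0)) :
    Approx A l (fun i => (A i).fadd (f i) (g i)) (x + y) (a + b + |x + y|) :=
  ⟨by filter_upwards [hf.1, hg.1] with i h1 h2 using (A i).fadd_mem _ h1 _ h2,
    (hf.2.add hg.2).round hu (by
      filter_upwards [hf.1, hg.1] with i h1 h2 using (A i).fadd_err _ h1 _ h2)⟩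

theorem fsub (hf : Approx A l f x a) (hg : Approx A l g y b) (hu : Tendsto u l (𝓝[>] 0)) :
    Approx A l (fun i => (A i).fsub (f i) (g i)) (x - y) (a + b + |x - y|) :=
  ⟨by filter_upwards [hf.1, hg.1] with i h1 h2 using (A i).fsub_mem _ h1 _ h2,
    (hf.2.sub hg.2).round hu (by
      filter_upwards [hf.1, hg.1] with i h1 h2 using (A i).fsub_err _ h1 _ h2)⟩

theorem fmul (hf : Approx A l f x a) (hg : Approx A l g y b) (hu : Tendsto u l (𝓝[>] 0)) :
    Approx A l (fun i => (A i).fmul (f i) (g i)) (x * y) (|x| * b + |y| * a + |x * y|) :=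
  ⟨by filter_upwards [hf.1, hg.1] with i h1 h2 using (A i).fmul_mem _ h1 _ h2,
    (hf.2.mul hg.2 hu).round hu (by
      filter_upwards [hf.1, hg.1] with i h1 h2 using (A i).fmul_err _ h1 _ h2)⟩

theorem fdiv (hf : Approx A l f x a) (hg : Approx A l g y (b * |y|)) (hy : y ≠ 0)
    (hu : Tendsto u l (𝓝[>] 0)) :
    Approx A l (fun i => (A i).fdiv (f i) (g i)) (x / y) (a / |y| + (b + 1) * |x / y|) := by
  -- The model says nothing about division by zero, but computed divisors converge to `y ≠ 0`.
  have hg0 : ∀ᶠ i in l, g i ≠ 0 := (hg.tendsto hu).eventually_ne hy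
  refine ⟨by filter_upwards [hf.1, hg.1, hg0] with i h1 h2 h3 using (A i).fdiv_mem _ h1 _ h2 h3, ?_⟩
  have h1 := (hf.2.mul (hg.2.comp (hasDerivAt_inv hy) hu) hu).round
    (g := fun i => (A i).fdiv (f i) (g i)) hu (by
      filter_upwards [hf.1, hg.1, hg0] with i h1 h2 h3 using by
        simpa only [div_eq_mul_inv] using (A i).fdiv_err _ h1 _ h2 h3)
  rw [← div_eq_mul_inv] at h1
  convert h1 using 1
  have : |y| ≠ 0 := abs_ne_zero.2 hy
  rw [abs_div, abs_neg, abs_inv, abs_inv, abs_pow]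
  field_simp
  ring

/-- The relative version of `Approx.fdiv`. -/
theorem fdiv_rel (hf : Approx A l f x (a * |x|)) (hg : Approx A l g y (b * |y|)) (hy : y ≠ 0)
    (hu : Tendsto u l (𝓝[>] 0)) :
    Approx A l (fun i => (A i).fdiv (f i) (g i)) (x / y) ((a + b + 1) * |x / y|) := by
  convert hf.fdiv hg hy hu using 1
  rw [abs_div]
  ring

theorem fexp (hf : Approx A l f x a) (hu : Tendsto u l (𝓝[>] 0)) :
    Approx A l (fun i => (A i).fexp (f i)) (Real.exp x) ((a + 1) * |Real.exp x|) := by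
  refine ⟨by filter_upwards [hf.1] with i h1 using (A i).fexp_mem _ h1, ?_⟩
  convert (hf.2.comp (Real.hasDerivAt_exp x) hu).round
    (g := fun i => (A i).fexp (f i)) hu (by
      filter_upwards [hf.1] with i h1 using (A i).fexp_err _ h1) using 1
  ring

theorem fsqrt (hf : Approx A l f x (a * x)) (hx : 0 < x) (hu : Tendsto u l (𝓝[>] 0)) :
    Approx A l (fun i => (A i).fsqrt (f i)) (√x) ((a / 2 + 1) * |√x|) := by
  have h0 : ∀ᶠ i in l, 0 ≤ f i := ((hf.tendsto hu).eventually (lt_mem_nhds hx)).mono fun _ => le_of_lt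
  refine ⟨by filter_upwards [hf.1, h0] with i h1 h2 using (A i).fsqrt_mem _ h1 h2, ?_⟩
  convert (hf.2.comp (Real.hasDerivAt_sqrt hx.ne') hu).round
    (g := fun i => (A i).fsqrt (f i)) hu (by
      filter_upwards [hf.1, h0] with i h1 h2 using (A i).fsqrt_err _ h1 h2) using 1
  have : 0 < √x := Real.sqrt_pos.2 hx
  rw [abs_of_pos this, abs_of_pos (by positivity)]
  field_simp
  rw [Real.sq_sqrt hx.le]
  ring

/-- Computed values eventually have the sign of `x ≠ 0`. An inactive unit is then exactly `0` and
carries no error, which is why `xiMlp` sums over the positive support only. -/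
theorem relu (hf : Approx A l f x a) (hx : x ≠ 0) (hu : Tendsto u l (𝓝[>] 0)) :
    Approx A l (fun i => max 0 (f i)) (max 0 x) (if 0 < x then a else 0) := by
  refine ⟨?_, ?_⟩
  · filter_upwards [hf.1] with i h1
    rcases max_choice 0 (f i) with h | h <;> rw [h]
    exacts [(A i).zero_mem, h1]
  have hr := hf.2
  split_ifs with h0
  · obtain ⟨r, hr, hf'⟩ := hr
    refine ⟨r, hr, ?_⟩
    filter_upwards [hf', (hf.tendsto hu).eventually (lt_mem_nhds h0)] with i h1 h2
    rwa [max_eq_right h0.le, max_eq_right (le_of_lt h2)]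
  · have h0 : x < 0 := lt_of_le_of_ne (not_lt.1 h0) hx
    refine .of_le ?_
    filter_upwards [(hf.tendsto hu).eventually (gt_mem_nhds h0)] with i h2
    rw [max_eq_left h0.le, max_eq_left (le_of_lt h2)]
    simp

/-- There are `m` additions for `m + 1` terms, and each rounds a partial sum bounded by `∑ |x k|`.
-/
theorem flSum {m : ℕ} {f : ι → Fin (m + 1) → ℝ} {x a : Fin (m + 1) → ℝ}
    (hf : ∀ k, Approx A l (fun i => f i k) (x k) (a k)) (hu : Tendsto u l (𝓝[>] 0)) :
    Approx A l (fun i => flSum (A i) (m + 1) (f i)) (∑ k, x k) (∑ k, a k + m * ∑ k, |x k|) := by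
  induction m with
  | zero => simpa [Transformer.flSum] using hf 0
  | succ m ih =>
    have h := (ih (fun k => hf k.castSucc)).fadd (hf (Fin.last (m + 1))) hu
    rw [← Fin.sum_univ_castSucc x] at h
    refine h.mono hu ?_
    have h1 := Finset.abs_sum_le_sum_abs x Finset.univ
    have h2 := abs_nonneg (x (Fin.last (m + 1)))
    have h3 : (0 : ℝ) ≤ m := m.cast_nonneg
    rw [Fin.sum_univ_castSucc a]
    rw [Fin.sum_univ_castSucc (fun k => |x k|)] at h1 ⊢
    push_cast
    nlinarith [mul_nonneg h3 h2]

theorem flDot {m : ℕ} {f g : ι → Fin m → ℝ} {x y a b : Fin m → ℝ}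
    (hf : ∀ k, Approx A l (fun i => f i k) (x k) (a k))
    (hg : ∀ k, Approx A l (fun i => g i k) (y k) (b k)) (hu : Tendsto u l (𝓝[>] 0)) :
    Approx A l (fun i => flDot (A i) (f i) (g i)) (x ⬝ᵥ y)
      (∑ k, (|x k| * b k + |y k| * a k) + m * ∑ k, |x k| * |y k|) := by
  cases m with
  | zero => simpa [Transformer.flDot, Transformer.flSum] using
      Approx.const (.of_forall fun i => (A i).zero_mem)
  | succ m =>
    convert Approx.flSum (fun k => (hf k).fmul (hg k) hu) hu using 1
    · rfl
    · rfl
    simp only [Finset.sum_add_distrib, abs_mul]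
    push_cast
    ring

/-- Componentwise relative version of `Approx.flDot`, with majorants `p`, `q` of the factors. -/
theorem flDot_rel {m : ℕ} {f g : ι → Fin m → ℝ} {x y p q : Fin m → ℝ} {a b : ℝ}
    (hf : ∀ k, Approx A l (fun i => f i k) (x k) (a * p k))
    (hg : ∀ k, Approx A l (fun i => g i k) (y k) (b * q k)) (hp : ∀ k, |x k| ≤ p k)
    (hq : ∀ k, |y k| ≤ q k) (ha : 0 ≤ a) (hb : 0 ≤ b) (hu : Tendsto u l (𝓝[>] 0)) :
    Approx A l (fun i => Transformer.flDot (A i) (f i) (g i)) (x ⬝ᵥ y)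
      ((a + b + m) * ∑ k, p k * q k) := by
  refine (Approx.flDot hf hg hu).mono hu ?_
  rw [Finset.mul_sum, Finset.mul_sum, ← Finset.sum_add_distrib]
  refine Finset.sum_le_sum fun k _ => ?_
  have hp0 := (abs_nonneg _).trans (hp k)
  have hq0 := (abs_nonneg _).trans (hq k)
  calc |x k| * (b * q k) + |y k| * (a * p k) + m * (|x k| * |y k|)
      ≤ p k * (b * q k) + q k * (a * p k) + m * (p k * q k) := by
        gcongr
        exacts [hp k, hq k, hp k, hq k]
    _ = _ := by ring

end Approx

/-! ### Singular values and the key-query factor -/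

section
-- Expand `‖T v‖² = ⟪v, T* T v⟫` in an eigenbasis of `T* T`; its eigenvalues are the squared
-- singular values, each at most the square of the first.
theorem norm_map_le_singularValues_zero {E F : Type*} [NormedAddCommGroup E]
    [InnerProductSpace ℝ E] [FiniteDimensional ℝ E] [NormedAddCommGroup F] [InnerProductSpace ℝ F]
    [FiniteDimensional ℝ F] (T : E →ₗ[ℝ] F) (v : E) : ‖T v‖ ≤ T.singularValues 0 * ‖v‖ := by
  refine le_of_sq_le_sq ?_ (mul_nonneg (T.singularValues_nonneg 0) (norm_nonneg v))
  have hs := T.isSymmetric_adjoint_comp_self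
  set e := hs.eigenvectorBasis rfl with he
  have h1 : ‖T v‖ ^ 2 = inner ℝ v ((LinearMap.adjoint T ∘ₗ T) v) := by
    rw [LinearMap.comp_apply, LinearMap.adjoint_inner_right, real_inner_self_eq_norm_sq]
  rw [h1, ← e.sum_inner_mul_inner, mul_pow, ← e.sum_sq_norm_inner_right v, Finset.mul_sum]
  refine Finset.sum_le_sum fun i _ => ?_
  rw [← hs, he, hs.apply_eigenvectorBasis, real_inner_smul_left, ← he, real_inner_comm v,
    Real.norm_eq_abs, sq_abs]
  rw [RCLike.ofReal_real_eq_id, id, ← T.sq_singularValues_fin rfl i]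
  have := pow_le_pow_left₀ (T.singularValues_nonneg i) (T.singularValues_antitone (Nat.zero_le i)) 2
  nlinarith [mul_le_mul_of_nonneg_right this (sq_nonneg (inner ℝ (e i) v))]

variable {d D : ℕ}

theorem dotProduct_mulVec_le_sigmaMax (M : Matrix (Fin d) (Fin d) ℝ) (x y : Fin d → ℝ) :
    x ⬝ᵥ (M *ᵥ y) ≤ sigmaMax M * (‖WithLp.toLp 2 x‖ * ‖WithLp.toLp 2 y‖) := by
  have h : x ⬝ᵥ (M *ᵥ y) = inner ℝ (WithLp.toLp 2 x) (Matrix.toEuclideanLin M (WithLp.toLp 2 y)) := by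
    simp [EuclideanSpace.inner_eq_star_dotProduct, dotProduct_comm, Matrix.toLpLin_apply]
  rw [h]
  refine (real_inner_le_norm _ _).trans ?_
  calc _ ≤ ‖WithLp.toLp 2 x‖ * (sigmaMax M * ‖WithLp.toLp 2 y‖) := by
        gcongr
        exact norm_map_le_singularValues_zero _ _
    _ = _ := by ring

theorem sigmaMax_nonneg (M : Matrix (Fin d) (Fin d) ℝ) : 0 ≤ sigmaMax M :=
  LinearMap.singularValues_nonneg _ _

theorem sigmaMin_pos (hd : 0 < d) {M : Matrix (Fin d) (Fin d) ℝ} (hM : M.det ≠ 0) :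
    0 < sigmaMin M := by
  refine (LinearMap.injective_iff_forall_lt_finrank_singularValues_pos _).1 ?_ _ (by simp; omega)
  intro v w h
  have h' : M *ᵥ v.ofLp = M *ᵥ w.ofLp := by
    simpa [Matrix.toLpLin_apply] using h
  have := Matrix.mulVec_injective_iff_isUnit.2 ((Matrix.isUnit_iff_isUnit_det M).2 hM.isUnit) h'
  exact WithLp.ofLp_injective 2 this

/-- Non-singularity makes the condition number a true quotient, at least 1. Only this lower bound on
it is used. -/
theorem le_keyQueryFactor (hd : 0 < d) (Θ : Config d D) (hW : (Θ.Wkᵀ * Θ.Wq).det ≠ 0) :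
    1 + 4 * √(d : ℝ) * sigmaMax ((Θ.Wk.map abs)ᵀ * Θ.Wq.map abs) ≤ keyQueryFactor Θ := by
  have h : 1 ≤ sigmaMax (Θ.Wkᵀ * Θ.Wq) / sigmaMin (Θ.Wkᵀ * Θ.Wq) :=
    (one_le_div (sigmaMin_pos hd hW)).2 (LinearMap.singularValues_antitone _ (Nat.zero_le _))
  have h0 := sigmaMax_nonneg ((Θ.Wk.map abs)ᵀ * Θ.Wq.map abs)
  unfold keyQueryFactor
  have : 0 ≤ 4 * √(d : ℝ) * sigmaMax ((Θ.Wk.map abs)ᵀ * Θ.Wq.map abs) := by positivity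
  nlinarith [mul_le_mul_of_nonneg_left h this]

theorem one_le_keyQueryFactor (hd : 0 < d) (Θ : Config d D) (hW : (Θ.Wkᵀ * Θ.Wq).det ≠ 0) :
    1 ≤ keyQueryFactor Θ := by
  have h0 := sigmaMax_nonneg ((Θ.Wk.map abs)ᵀ * Θ.Wq.map abs)
  exact le_trans (le_add_of_nonneg_right (by positivity)) (le_keyQueryFactor hd Θ hW)

end

/-! ### Exact identities for the two normalizations -/

theorem norm_toLp_sq {d : ℕ} (x : Fin d → ℝ) : ‖WithLp.toLp 2 x‖ ^ 2 = x ⬝ᵥ x := by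
  rw [EuclideanSpace.norm_sq_eq]
  simp [dotProduct, pow_two]

theorem norm_toLp_pos {d : ℕ} {x : Fin d → ℝ} (hx : x ≠ 0) : 0 < ‖WithLp.toLp 2 x‖ :=
  norm_pos_iff.2 fun h => hx (by simpa using congrArg WithLp.ofLp h)

theorem norm_rmsNorm {d : ℕ} {x : Fin d → ℝ} (hx : x ≠ 0) :
    ‖WithLp.toLp 2 (rmsNorm x)‖ = √(d : ℝ) := by
  have h := norm_toLp_pos hx
  have : WithLp.toLp 2 (rmsNorm x) = (√(d : ℝ) / ‖WithLp.toLp 2 x‖) • WithLp.toLp 2 x := by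
    ext i
    simp [rmsNorm, div_mul_eq_mul_div, mul_div_assoc]
  rw [this, norm_smul, Real.norm_eq_abs, abs_of_nonneg (by positivity), div_mul_cancel₀ _ h.ne']

theorem layerNorm_eq_rmsNorm_centr {d : ℕ} (x : Fin d → ℝ) : layerNorm x = rmsNorm (centr x) := by
  ext i
  have : variance x = ‖WithLp.toLp 2 (centr x)‖ ^ 2 / d := by
    rw [norm_toLp_sq]
    simp [variance, dotProduct, centr, pow_two]
  rw [layerNorm, rmsNorm, this, Real.sqrt_div (sq_nonneg _), Real.sqrt_sq (norm_nonneg _)]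
  simp only [centr]
  rw [div_div_eq_mul_div]
  ring

/-! ### Computed RMS normalization, matrix-vector products and softmax -/

namespace Approx

variable {ι : Type*} {l : Filter ι} {u : ι → ℝ} {A : ∀ i, FloatArith (u i)}

/-- The numerator contributes `ε + 2`. The squared norm is a sum without cancellation, with relative
error `2ε + d`; the root halves this and adds 1, and the division adds 1. -/
theorem flRmsNorm {d : ℕ} {s : ι → ℝ} {xh : ι → Fin d → ℝ} {x : Fin d → ℝ} {ε : ℝ}
    (hs : Approx A l s √(d : ℝ) (1 * |√(d : ℝ)|))
    (hx : ∀ k, Approx A l (fun i => xh i k) (x k) (ε * |x k|)) (hε : 0 ≤ ε) (hx0 : x ≠ 0)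
    (hu : Tendsto u l (𝓝[>] 0)) (k : Fin d) :
    Approx A l (fun i => flRmsNorm (A i) (s i) (xh i) k) (rmsNorm x k)
      ((2 * ε + d / 2 + 4) * |rmsNorm x k|) := by
  have hpos := norm_toLp_pos hx0
  have hdot := flDot_rel hx hx (fun _ => le_rfl) (fun _ => le_rfl) hε hε hu
  have hsum : ∑ k, |x k| * |x k| = x ⬝ᵥ x := by simp [dotProduct]
  rw [hsum, ← norm_toLp_sq] at hdot
  have hr := hdot.fsqrt (by positivity) hu
  rw [Real.sqrt_sq hpos.le] at hr
  have hm := hs.fmul (hx k) hu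
  have h := (hm.mono (b := (ε + 2) * |√(d : ℝ) * x k|) hu (le_of_eq (by rw [abs_mul]; ring))).fdiv_rel
    hr hpos.ne' hu
  rw [mul_div_assoc] at h
  exact h.mono hu (le_of_eq (by rw [rmsNorm]; ring))

theorem flMulVec {p m : ℕ} {Mh : ι → Matrix (Fin p) (Fin m) ℝ} {M : Matrix (Fin p) (Fin m) ℝ}
    {xh : ι → Fin m → ℝ} {x q : Fin m → ℝ} {e a : ℝ} {j : Fin p}
    (hM : ∀ k, Approx A l (fun i => Mh i j k) (M j k) (e * |M j k|))
    (hx : ∀ k, Approx A l (fun i => xh i k) (x k) (a * q k)) (hq : ∀ k, |x k| ≤ q k)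
    (he : 0 ≤ e) (ha : 0 ≤ a) (hu : Tendsto u l (𝓝[>] 0)) :
    Approx A l (fun i => flMulVec (A i) (Mh i) (xh i) j) ((M *ᵥ x) j)
      ((e + a + m) * ((M.map abs) *ᵥ q) j) :=
  flDot_rel hM hx (fun _ => le_rfl) hq he ha hu

theorem flMulVec_const {p m : ℕ} {M : Matrix (Fin p) (Fin m) ℝ}
    {xh : ι → Fin m → ℝ} {x q : Fin m → ℝ} {a : ℝ} {j : Fin p}
    (hM : ∀ k, ∀ᶠ i in l, M j k ∈ (A i).F)
    (hx : ∀ k, Approx A l (fun i => xh i k) (x k) (a * q k)) (hq : ∀ k, |x k| ≤ q k)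
    (ha : 0 ≤ a) (hu : Tendsto u l (𝓝[>] 0)) :
    Approx A l (fun i => Transformer.flMulVec (A i) M (xh i) j) ((M *ᵥ x) j)
      ((a + m) * ((M.map abs) *ᵥ q) j) := by
  simpa using flMulVec (Mh := fun _ => M) (M := M) (e := 0) (j := j)
    (fun k => by simpa using Approx.const (hM k)) hx hq le_rfl ha hu

/-- An absolute error `δ` of the scores becomes a relative error `δ + 1` of the exponentials. Their
sum has positive terms, so it only adds `m`, and the division adds 1. -/
theorem flSoftmax {m : ℕ} {zh : ι → Fin (m + 1) → ℝ} {z : Fin (m + 1) → ℝ} {δ : ℝ}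
    (hz : ∀ j, Approx A l (fun i => zh i j) (z j) δ) (hu : Tendsto u l (𝓝[>] 0))
    (j : Fin (m + 1)) :
    Approx A l (fun i => flSoftmax (A i) (zh i) j) (softmax z j)
      ((2 * δ + m + 3) * |softmax z j|) := by
  have he := fun j => (hz j).fexp hu
  have hpos : 0 < ∑ k, Real.exp (z k) :=
    Finset.sum_pos (fun _ _ => Real.exp_pos _) Finset.univ_nonempty
  have hs := Approx.flSum he hu
  have h := (he j).fdiv_rel (b := δ + 1 + m) (hs.mono hu (le_of_eq ?_)) hpos.ne' hu
  · exact h.mono hu (le_of_eq (by rw [softmax]; ring))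
  · simp only [Real.abs_exp, ← Finset.mul_sum, abs_of_pos hpos]
    ring

end Approx

/-! ### Majorants and attention scores -/

theorem abs_mulVec_le {p m : ℕ} (M : Matrix (Fin p) (Fin m) ℝ) {x q : Fin m → ℝ}
    (hq : ∀ k, |x k| ≤ q k) (j : Fin p) : |(M *ᵥ x) j| ≤ (M.map abs *ᵥ q) j := by
  simp only [Matrix.mulVec, dotProduct, Matrix.map_apply]
  refine (Finset.abs_sum_le_sum_abs _ _).trans (Finset.sum_le_sum fun k _ => ?_)
  rw [abs_mul]
  exact mul_le_mul_of_nonneg_left (hq k) (abs_nonneg _)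

theorem mulVec_map_abs_nonneg {p m : ℕ} (M : Matrix (Fin p) (Fin m) ℝ) {q : Fin m → ℝ}
    (hq : ∀ k, 0 ≤ q k) (j : Fin p) : 0 ≤ (M.map abs *ᵥ q) j := by
  simp only [Matrix.mulVec, dotProduct, Matrix.map_apply]
  exact Finset.sum_nonneg fun k _ => mul_nonneg (abs_nonneg _) (hq k)

theorem scores_apply {d D m : ℕ} (Θ : Config d D) (X : Matrix (Fin d) (Fin (m + 1)) ℝ)
    (j : Fin (m + 1)) : scores Θ X j =
      ((Θ.Wk *ᵥ X.col j) ⬝ᵥ (Θ.Wq *ᵥ X.col (Fin.last m))) / √(d : ℝ) := by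
  simp only [scores, Pi.smul_apply, smul_eq_mul, one_div_mul_eq_div]
  rfl

theorem norm_toLp_abs {d : ℕ} (x : Fin d → ℝ) :
    ‖WithLp.toLp 2 (fun k => |x k|)‖ = ‖WithLp.toLp 2 x‖ := by
  simp [EuclideanSpace.norm_eq]

theorem abs_key_dotProduct_abs_query_le {d D : ℕ} (Θ : Config d D) (x y : Fin d → ℝ) :
    ∑ k, (Θ.Wk.map abs *ᵥ fun i => |x i|) k * (Θ.Wq.map abs *ᵥ fun i => |y i|) k ≤
      sigmaMax ((Θ.Wk.map abs)ᵀ * Θ.Wq.map abs) * (‖WithLp.toLp 2 x‖ * ‖WithLp.toLp 2 y‖) := by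
  rw [← norm_toLp_abs x, ← norm_toLp_abs y]
  refine le_trans (le_of_eq ?_) (dotProduct_mulVec_le_sigmaMax _ _ _)
  rw [← Matrix.mulVec_mulVec, Matrix.dotProduct_mulVec, Matrix.vecMul_transpose]
  rfl

namespace Approx

variable {ι : Type*} {l : Filter ι} {u : ι → ℝ} {A : ∀ i, FloatArith (u i)}

/-- The bound is absolute, as the exponential requires. Keys and queries contribute `ε + d` each and
their dot product `d`, all relative to a majorant at most `σ d`; the factor `s` and the division
contribute 2. Dividing by `√d` leaves `√d σ`. -/
theorem flScores {d D m : ℕ} (hd : 0 < d) {s : ι → ℝ} {Θ : Config d D}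
    (hs : Approx A l s √(d : ℝ) (1 * |√(d : ℝ)|)) (hΘ : ∀ᶠ i in l, Θ.IsFloat (A i))
    {Rh : ι → Matrix (Fin d) (Fin (m + 1)) ℝ} {R : Matrix (Fin d) (Fin (m + 1)) ℝ} {ε : ℝ}
    (hR : ∀ k t, Approx A l (fun i => Rh i k t) (R k t) (ε * |R k t|)) (hε : 0 ≤ ε)
    (hn : ∀ t, ‖WithLp.toLp 2 (R.col t)‖ = √(d : ℝ)) (hu : Tendsto u l (𝓝[>] 0))
    (j : Fin (m + 1)) :
    Approx A l (fun i => flScores (A i) (s i) Θ (Rh i) j) (scores Θ R j)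
      ((2 * ε + 3 * d + 2) * (√(d : ℝ) * sigmaMax ((Θ.Wk.map abs)ᵀ * Θ.Wq.map abs))) := by
  have hsq : 0 < √(d : ℝ) := Real.sqrt_pos.2 (by exact_mod_cast hd)
  have hk : ∀ k, Approx A l (fun i => Transformer.flMulVec (A i) Θ.Wk ((Rh i).col j) k)
      ((Θ.Wk *ᵥ R.col j) k) ((ε + d) * (Θ.Wk.map abs *ᵥ fun i => |R.col j i|) k) := fun k =>
    flMulVec_const (fun k' => hΘ.mono fun i h => h.2.2.2.2.2.1 k k')
      (fun k' => hR k' j) (fun _ => le_rfl) hε hu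
  have hq : ∀ k, Approx A l (fun i => Transformer.flMulVec (A i) Θ.Wq ((Rh i).col (Fin.last m)) k)
      ((Θ.Wq *ᵥ R.col (Fin.last m)) k)
      ((ε + d) * (Θ.Wq.map abs *ᵥ fun i => |R.col (Fin.last m) i|) k) := fun k =>
    flMulVec_const (fun k' => hΘ.mono fun i h => h.2.2.2.2.1 k k')
      (fun k' => hR k' _) (fun _ => le_rfl) hε hu
  have hk' := abs_mulVec_le Θ.Wk (x := R.col j) (fun _ => le_rfl)
  have hq' := abs_mulVec_le Θ.Wq (x := R.col (Fin.last m)) (fun _ => le_rfl)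
  have h := (flDot_rel hk hq hk' hq' (by positivity) (by positivity) hu).fdiv hs hsq.ne' hu
  rw [scores_apply]
  refine h.mono hu ?_
  have hS := abs_key_dotProduct_abs_query_le Θ (R.col j) (R.col (Fin.last m))
  have hD : |(Θ.Wk *ᵥ R.col j) ⬝ᵥ (Θ.Wq *ᵥ R.col (Fin.last m))| ≤
      ∑ k, (Θ.Wk.map abs *ᵥ fun i => |R.col j i|) k *
        (Θ.Wq.map abs *ᵥ fun i => |R.col (Fin.last m) i|) k := by
    refine (Finset.abs_sum_le_sum_abs _ _).trans (Finset.sum_le_sum fun k _ => ?_)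
    rw [abs_mul]
    exact mul_le_mul (hk' k) (hq' k) (abs_nonneg _) ((abs_nonneg _).trans (hk' k))
  rw [hn, hn] at hS
  set S := ∑ k, (Θ.Wk.map abs *ᵥ fun i => |R.col j i|) k *
        (Θ.Wq.map abs *ᵥ fun i => |R.col (Fin.last m) i|) k
  set σ := sigmaMax ((Θ.Wk.map abs)ᵀ * Θ.Wq.map abs)
  rw [abs_div, abs_of_pos hsq]
  calc (ε + d + (ε + d) + d) * S / √(d : ℝ) +
        (1 + 1) * (|(Θ.Wk *ᵥ R.col j) ⬝ᵥ (Θ.Wq *ᵥ R.col (Fin.last m))| / √(d : ℝ))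
      ≤ (ε + d + (ε + d) + d) * (σ * (√(d : ℝ) * √(d : ℝ))) / √(d : ℝ) +
        (1 + 1) * ((σ * (√(d : ℝ) * √(d : ℝ))) / √(d : ℝ)) := by
        gcongr
        exact hD.trans hS
    _ = _ := by
        field_simp
        ring

end Approx

/-! ### Majorants for mean, perceptron and attention -/

theorem softmax_nonneg {m : ℕ} (z : Fin m → ℝ) (j : Fin m) : 0 ≤ softmax z j :=
  div_nonneg (Real.exp_pos _).le (Finset.sum_nonneg fun _ _ => (Real.exp_pos _).le)

theorem sum_abs_le_card_mul_norm {d : ℕ} (x : Fin d → ℝ) : ∑ k, |x k| ≤ d * ‖x‖ := by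
  simpa using Finset.sum_le_card_nsmul Finset.univ (fun k => |x k|) ‖x‖
    fun k _ => norm_le_pi_norm x k

theorem abs_mean_le {d : ℕ} (hd : 0 < d) (x : Fin d → ℝ) : |mean x| ≤ ‖x‖ := by
  have hd' : (0 : ℝ) < d := by exact_mod_cast hd
  rw [mean, abs_div, abs_of_pos hd', div_le_iff₀ hd', mul_comm]
  exact (Finset.abs_sum_le_sum_abs _ _).trans (sum_abs_le_card_mul_norm x)

/-- The numerator of `xiMlp`. -/
noncomputable def mlpMajorant {d D : ℕ} (Θ : Config d D) (x : Fin d → ℝ) (i : Fin d) : ℝ :=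
  ∑ k with 0 < affine₁ Θ x k, |Θ.A₂ i k| * (∑ j, |Θ.A₁ k j| * |x j| + |Θ.b₁ k|) + |Θ.b₂ i|

theorem abs_affine₁_le {d D : ℕ} (Θ : Config d D) (x : Fin d → ℝ) (k : Fin D) :
    |affine₁ Θ x k| ≤ ∑ j, |Θ.A₁ k j| * |x j| + |Θ.b₁ k| :=
  (abs_add_le _ _).trans (add_le_add_left (abs_mulVec_le Θ.A₁ (fun _ => le_rfl) k) _)

theorem mlpMajorant_eq {d D : ℕ} (Θ : Config d D) (x : Fin d → ℝ) (i : Fin d) :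
    mlpMajorant Θ x i = (Θ.A₂.map abs *ᵥ fun k =>
      if 0 < affine₁ Θ x k then ∑ j, |Θ.A₁ k j| * |x j| + |Θ.b₁ k| else 0) i + |Θ.b₂ i| := by
  simp [mlpMajorant, Finset.sum_filter, Matrix.mulVec, dotProduct, mul_ite]

theorem abs_relu_affine₁_le {d D : ℕ} (Θ : Config d D) (x : Fin d → ℝ) (k : Fin D) :
    |max 0 (affine₁ Θ x k)| ≤
      if 0 < affine₁ Θ x k then ∑ j, |Θ.A₁ k j| * |x j| + |Θ.b₁ k| else 0 := by
  split_ifs with h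
  · rw [max_eq_right h.le]
    exact abs_affine₁_le Θ x k
  · rw [max_eq_left (not_lt.1 h), abs_zero]

theorem abs_mlp_le {d D : ℕ} (Θ : Config d D) (x : Fin d → ℝ) (i : Fin d) :
    |mlp Θ x i| ≤ mlpMajorant Θ x i := by
  rw [mlpMajorant_eq]
  exact (abs_add_le _ _).trans
    (add_le_add_left (abs_mulVec_le Θ.A₂ (abs_relu_affine₁_le Θ x) i) _)

/-- The numerator of `xiAttn`. -/
noncomputable def attnMajorant {d D n : ℕ} (Θ : Config d D) (X : Matrix (Fin d) (Fin n) ℝ) (i : Fin d)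
    (t : Fin n) : ℝ :=
  (Θ.Wv.map abs *ᵥ ((firstCols X t).map abs *ᵥ softmax (scores Θ (firstCols X t)))) i

theorem attnMajorant_nonneg {d D n : ℕ} (Θ : Config d D) (X : Matrix (Fin d) (Fin n) ℝ)
    (i : Fin d) (t : Fin n) : 0 ≤ attnMajorant Θ X i t :=
  mulVec_map_abs_nonneg _ (mulVec_map_abs_nonneg _ (softmax_nonneg _)) _

theorem abs_attn_le {d D n : ℕ} (Θ : Config d D) (X : Matrix (Fin d) (Fin n) ℝ) (i : Fin d)
    (t : Fin n) : |attn Θ X i t| ≤ attnMajorant Θ X i t :=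
  abs_mulVec_le _ (fun k => abs_mulVec_le _ (fun j => (abs_of_nonneg (softmax_nonneg _ j)).le) k) i

/-! ### Computed centring, layer normalization, attention and perceptron -/

namespace Approx

variable {ι : Type*} {l : Filter ι} {u : ι → ℝ} {A : ∀ i, FloatArith (u i)}

/-- Errors of `x k` and of the mean are relative to `‖x‖`: `ε` from the entry and `ε + d` from the
mean. The constant `c` converts them to the scale of the centred entry, and the subtraction adds 1.
-/
theorem flCentr {d : ℕ} (hd : 0 < d) (hdF : ∀ᶠ i in l, (d : ℝ) ∈ (A i).F)
    {xh : ι → Fin d → ℝ} {x : Fin d → ℝ} {ε c : ℝ}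
    (hx : ∀ k, Approx A l (fun i => xh i k) (x k) (ε * |x k|)) (hε : 0 ≤ ε)
    (hc : ∀ k, ‖x‖ ≤ c * |centr x k|) (hu : Tendsto u l (𝓝[>] 0)) (k : Fin d) :
    Approx A l (fun i => flCentr (A i) (xh i) k) (centr x k)
      (((2 * ε + d) * c + 1) * |centr x k|) := by
  obtain ⟨m, rfl⟩ : ∃ m, d = m + 1 := ⟨d - 1, by omega⟩
  have hd' : (0 : ℝ) < (m + 1 : ℕ) := by positivity
  have hmean := (flSum hx hu).fdiv (b := 0) ((const hdF).mono hu (by simp)) hd'.ne' hu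
  refine ((hx k).fsub hmean hu).mono hu ?_
  have h1 := sum_abs_le_card_mul_norm x
  have h2 := abs_mean_le hd x
  have h3 : |x k| ≤ ‖x‖ := norm_le_pi_norm x k
  rw [← Finset.mul_sum, ← add_mul, abs_of_pos hd']
  change ε * |x k| + (((ε + m) * ∑ k, |x k|) / (m + 1 : ℕ) + (0 + 1) * |mean x|) +
    |centr x k| ≤ _
  calc ε * |x k| + (((ε + m) * ∑ k, |x k|) / (m + 1 : ℕ) + (0 + 1) * |mean x|) + |centr x k|
      ≤ ε * ‖x‖ + (((ε + m) * ((m + 1 : ℕ) * ‖x‖)) / (m + 1 : ℕ) + (0 + 1) * ‖x‖) +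
          |centr x k| := by gcongr
    _ = (2 * ε + (m + 1 : ℕ)) * ‖x‖ + |centr x k| := by
        field_simp
        push_cast
        ring
    _ ≤ (2 * ε + (m + 1 : ℕ)) * (c * |centr x k|) + |centr x k| := by
        gcongr
        exact hc k
    _ = _ := by ring

theorem flLayerNorm {d : ℕ} (hd : 0 < d) {s : ι → ℝ}
    (hs : Approx A l s √(d : ℝ) (1 * |√(d : ℝ)|)) (hdF : ∀ᶠ i in l, (d : ℝ) ∈ (A i).F)
    {xh : ι → Fin d → ℝ} {x : Fin d → ℝ} {ε c : ℝ}
    (hx : ∀ k, Approx A l (fun i => xh i k) (x k) (ε * |x k|)) (hε : 0 ≤ ε) (hc0 : 0 ≤ c)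
    (hc : ∀ k, ‖x‖ ≤ c * |centr x k|) (hx0 : centr x ≠ 0) (hu : Tendsto u l (𝓝[>] 0))
    (k : Fin d) :
    Approx A l (fun i => flLayerNorm (A i) (s i) (xh i) k) (layerNorm x k)
      ((4 * c * ε + (2 * d * c + d / 2 + 6)) * |layerNorm x k|) := by
  rw [layerNorm_eq_rmsNorm_centr]
  refine (flRmsNorm hs (flCentr hd hdF hx hε hc hu) (by positivity) hx0 hu k).mono hu
    (le_of_eq ?_)
  ring

theorem flAttn {d D n : ℕ} (hd : 0 < d) {s : ι → ℝ} {Θ : Config d D}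
    (hW : (Θ.Wkᵀ * Θ.Wq).det ≠ 0)
    (hs : Approx A l s √(d : ℝ) (1 * |√(d : ℝ)|)) (hΘ : ∀ᶠ i in l, Θ.IsFloat (A i))
    {Rh : ι → Matrix (Fin d) (Fin n) ℝ} {R : Matrix (Fin d) (Fin n) ℝ} {ε : ℝ}
    (hR : ∀ k t, Approx A l (fun i => Rh i k t) (R k t) (ε * |R k t|)) (hε : 0 ≤ ε)
    (hn : ∀ t, ‖WithLp.toLp 2 (R.col t)‖ = √(d : ℝ)) (hu : Tendsto u l (𝓝[>] 0))
    (j : Fin d) (t : Fin n) :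
    Approx A l (fun i => flAttn (A i) (s i) Θ (Rh i) j t) (attn Θ R j t)
      (keyQueryFactor Θ * (ε + 2 * n + 3 / 2 * d + 2) * attnMajorant Θ R j t) := by
  have hR' : ∀ k t', Approx A l (fun i => firstCols (Rh i) t k t') (firstCols R t k t')
      (ε * |firstCols R t k t'|) := fun k t' => hR k _
  have hz := flScores hd hs hΘ hR' hε (fun t' => hn _) hu
  have hσ := sigmaMax_nonneg ((Θ.Wk.map abs)ᵀ * Θ.Wq.map abs)
  have hψ := flSoftmax hz hu
  have hψ' : ∀ k, |softmax (scores Θ (firstCols R t)) k| ≤ softmax (scores Θ (firstCols R t)) k :=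
    fun k => (abs_of_nonneg (softmax_nonneg _ k)).le
  have h1 := fun k => flMulVec (j := k) (hR' k) (q := softmax (scores Θ (firstCols R t)))
    (fun k => (hψ k).mono hu (mul_le_mul_of_nonneg_left (hψ' k) (by positivity))) hψ' hε
    (by positivity) hu
  have h2 := flMulVec_const (M := Θ.Wv) (j := j)
    (fun k => hΘ.mono fun i h => h.2.2.2.2.2.2 j k) h1 (abs_mulVec_le _ hψ')
    (by positivity) hu
  refine h2.mono hu (mul_le_mul_of_nonneg_right ?_ (attnMajorant_nonneg Θ R j t))
  have hK := le_keyQueryFactor hd Θ hW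
  have hsq := Real.sqrt_nonneg (d : ℝ)
  have ht : (t : ℝ) + 1 ≤ n := by exact_mod_cast t.isLt
  have hd0 : (0 : ℝ) < d := by exact_mod_cast hd
  set σ := sigmaMax ((Θ.Wk.map abs)ᵀ * Θ.Wq.map abs)
  have hg : 0 ≤ √(d : ℝ) * σ := by positivity
  -- With `g = √d σ`, the accumulated factor is at most `ε + 2n + d + 2 + 2g(2ε + 3d + 2)`. The
  -- coefficient `3/2` of `d` makes `4g · (3/2)d` match `2g · 3d`.
  refine le_trans ?_ (mul_le_mul_of_nonneg_right hK (by positivity))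
  push_cast
  nlinarith [mul_nonneg hg (Nat.cast_nonneg (α := ℝ) n)]

/-- Sums of approximations that are subject to the amplification factor `ξ`. -/
theorem fadd_rel {f g : ι → ℝ} {x y a b ξ : ℝ} (hf : Approx A l f x (a * |x|))
    (hg : Approx A l g y (b * |y|)) (hab : a ≤ b) (hb : 0 ≤ b) (hξ : |x| + |y| ≤ ξ * |x + y|)
    (hξ1 : 1 ≤ ξ) (hu : Tendsto u l (𝓝[>] 0)) :
    Approx A l (fun i => (A i).fadd (f i) (g i)) (x + y) (ξ * (b + 1) * |x + y|) := by
  refine (hf.fadd hg hu).mono hu ?_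
  nlinarith [mul_le_mul_of_nonneg_right hab (abs_nonneg x), mul_le_mul_of_nonneg_left hξ hb,
    mul_le_mul_of_nonneg_right hξ1 (abs_nonneg (x + y))]

theorem flMlp {d D : ℕ} {Θ : Config d D} (hΘ : ∀ᶠ i in l, Θ.IsFloat (A i))
    {rh : ι → Fin d → ℝ} {r : Fin d → ℝ} {ε : ℝ}
    (hr : ∀ k, Approx A l (fun i => rh i k) (r k) (ε * |r k|)) (hε : 0 ≤ ε)
    (h0 : ∀ k, affine₁ Θ r k ≠ 0) (hu : Tendsto u l (𝓝[>] 0)) (j : Fin d) :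
    Approx A l (fun i => flMlp (A i) Θ (rh i) j) (mlp Θ r j)
      ((ε + d + D + 2) * mlpMajorant Θ r j) := by
  have h1 : ∀ k, Approx A l (fun i => flAffine (A i) Θ.A₁ Θ.b₁ (rh i) k) (affine₁ Θ r k)
      ((ε + d + 1) * (∑ j, |Θ.A₁ k j| * |r j| + |Θ.b₁ k|)) := fun k => by
    have h := (flMulVec_const (M := Θ.A₁) (j := k) (fun k' => hΘ.mono fun i h => h.1 k k') hr
      (fun _ => le_rfl) hε hu).fadd (const (hΘ.mono fun i h => h.2.1 k)) hu
    refine h.mono hu ?_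
    have h2 := abs_affine₁_le Θ r k
    have h3 : (Θ.A₁.map abs *ᵥ fun j => |r j|) k = ∑ j, |Θ.A₁ k j| * |r j| := rfl
    change _ + |affine₁ Θ r k| ≤ _
    rw [h3]
    nlinarith [mul_nonneg (add_nonneg hε d.cast_nonneg) (abs_nonneg (Θ.b₁ k))]
  have h2 := fun k => (h1 k).relu (h0 k) hu
  have h3 := (flMulVec_const (M := Θ.A₂) (j := j) (a := ε + d + 1)
    (q := fun k => if 0 < affine₁ Θ r k then ∑ j, |Θ.A₁ k j| * |r j| + |Θ.b₁ k| else 0)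
    (fun k => hΘ.mono fun i h => h.2.2.1 j k)
    (fun k => (h2 k).mono hu (le_of_eq (by rw [mul_ite, mul_zero])))
    (abs_relu_affine₁_le Θ r) (by positivity) hu).fadd
    (const (hΘ.mono fun i h => h.2.2.2.1 j)) hu
  refine h3.mono hu ?_
  have h4 := abs_mlp_le Θ r j
  change _ + |mlp Θ r j| ≤ _
  rw [mlpMajorant_eq] at h4 ⊢
  nlinarith [mul_nonneg (show 0 ≤ ε + d + D + 1 by positivity) (abs_nonneg (Θ.b₂ j))]

end Approx

/-! ### Amplification factors in `ℝ≥0∞` -/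

section

theorem abs_le_of_absRatio_le {a b : ℝ} {c : ℝ≥0∞} (h : absRatio a b ≤ c) (hc : c ≠ ⊤) :
    |a| ≤ c.toReal * |b| := by
  rw [absRatio, ENNReal.div_le_iff_le_mul (.inr hc) (.inl ENNReal.ofReal_ne_top)] at h
  have := ENNReal.toReal_mono (ENNReal.mul_ne_top hc ENNReal.ofReal_ne_top) h
  simpa using this

/-- The condition `a ≠ 0` excludes the convention `0 / 0 = 0`; this is where genericity of the
network's outputs is needed. -/
theorem one_le_absRatio {a b : ℝ} (h : |b| ≤ |a|) (ha : a ≠ 0) : 1 ≤ absRatio a b := by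
  rw [absRatio, ENNReal.le_div_iff_mul_le (.inr (by simpa using ha)) (.inl ENNReal.ofReal_ne_top),
    one_mul]
  exact ENNReal.ofReal_le_ofReal h

theorem relDist_le {d n : ℕ} {Xh X : Matrix (Fin d) (Fin n) ℝ} {c : ℝ} (hc : 0 ≤ c)
    (h : ∀ i t, |Xh i t - X i t| ≤ c * |X i t|) : relDist Xh X ≤ ENNReal.ofReal c := by
  refine iSup_le fun i => iSup_le fun t => ENNReal.div_le_of_le_mul ?_
  rw [← ENNReal.ofReal_mul hc]
  exact ENNReal.ofReal_le_ofReal (h i t)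

theorem xiAdd_spec {d : ℕ} {x z : Fin d → ℝ} (h : xiAdd x z ≠ ⊤) (i : Fin d) :
    |x i| + |z i| ≤ (xiAdd x z).toReal * |x i + z i| := by
  rw [← abs_of_nonneg (add_nonneg (abs_nonneg (x i)) (abs_nonneg (z i)))]
  exact abs_le_of_absRatio_le (le_iSup (fun i => absRatio (|x i| + |z i|) (x i + z i)) i) h

theorem one_le_xiAdd {d : ℕ} {x z : Fin d → ℝ} {i : Fin d} (h : z i ≠ 0) : 1 ≤ xiAdd x z := by
  have := abs_pos.2 h
  refine le_iSup_of_le i (one_le_absRatio ?_ (by positivity))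
  exact (abs_add_le _ _).trans (le_abs_self _)

theorem xiMlp_spec {d D : ℕ} {Θ : Config d D} {x : Fin d → ℝ} (h : xiMlp Θ x ≠ ⊤) (i : Fin d) :
    mlpMajorant Θ x i ≤ (xiMlp Θ x).toReal * |mlp Θ x i| :=
  (le_abs_self _).trans (abs_le_of_absRatio_le
    (le_iSup (fun i => absRatio (mlpMajorant Θ x i) (mlp Θ x i)) i) h)

theorem one_le_xiMlp {d D : ℕ} {Θ : Config d D} {x : Fin d → ℝ} {i : Fin d}
    (h : mlp Θ x i ≠ 0) : 1 ≤ xiMlp Θ x :=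
  le_iSup_of_le i (one_le_absRatio (a := mlpMajorant Θ x i)
    ((abs_mlp_le Θ x i).trans (le_abs_self _))
    (ne_of_gt ((abs_pos.2 h).trans_le (abs_mlp_le Θ x i))))

theorem xiAttn_spec {d D n : ℕ} {Θ : Config d D} {X : Matrix (Fin d) (Fin n) ℝ}
    (h : xiAttn Θ X ≠ ⊤) (i : Fin d) (t : Fin n) :
    attnMajorant Θ X i t ≤ (xiAttn Θ X).toReal * |attn Θ X i t| :=
  (le_abs_self _).trans (abs_le_of_absRatio_le
    (le_iSup₂ (f := fun i t => absRatio (attnMajorant Θ X i t) (attn Θ X i t)) i t) h)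

theorem one_le_xiAttn {d D n : ℕ} {Θ : Config d D} {X : Matrix (Fin d) (Fin n) ℝ} {i : Fin d}
    {t : Fin n} (h : attn Θ X i t ≠ 0) : 1 ≤ xiAttn Θ X :=
  le_iSup₂_of_le i t (one_le_absRatio (a := attnMajorant Θ X i t)
    ((abs_attn_le Θ X i t).trans (le_abs_self _))
    (ne_of_gt ((abs_pos.2 h).trans_le (abs_attn_le Θ X i t))))

theorem one_le_blockXi {d D n : ℕ} {N : (Fin d → ℝ) → Fin d → ℝ} {Θ : Config d D}
    {X : Matrix (Fin d) (Fin n) ℝ} (i : Fin d) (t : Fin n)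
    (hA : attn Θ (colMap N X) i t ≠ 0) (hM : mlp Θ (N ((attnBlock N Θ X).col t)) i ≠ 0) :
    1 ≤ blockXi N Θ X :=
  one_le_mul (one_le_mul
    (le_iSup_of_le t (one_le_mul (one_le_xiAdd hM) (one_le_xiMlp hM)))
    (le_iSup_of_le t (one_le_xiAdd (i := i) hA))) (one_le_xiAttn hA)

/-- The lower bounds rule out `0 * ⊤ = 0`, which would hide an infinite factor. -/
theorem ne_top_of_mul_ne_top {a b : ℝ≥0∞} (h : a * b ≠ ⊤) (ha : 1 ≤ a) (hb : 1 ≤ b) :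
    a ≠ ⊤ ∧ b ≠ ⊤ := by
  refine ⟨fun h' => h ?_, fun h' => h ?_⟩
  · rw [h', ENNReal.top_mul (zero_lt_one.trans_le hb).ne']
  · rw [h', ENNReal.mul_top (zero_lt_one.trans_le ha).ne']

theorem ne_top_of_blockXi_ne_top {d D n : ℕ} {N : (Fin d → ℝ) → Fin d → ℝ} {Θ : Config d D}
    {X : Matrix (Fin d) (Fin n) ℝ} (k : Fin d) (t : Fin n)
    (hattn : ∀ t, Generic ((attn Θ (colMap N X)).col t))
    (hmlp : ∀ t, Generic (mlp Θ (N ((attnBlock N Θ X).col t)))) (h : blockXi N Θ X ≠ ⊤) :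
    (⨆ t, xiAdd ((attnBlock N Θ X).col t) (mlp Θ (N ((attnBlock N Θ X).col t))) *
      xiMlp Θ (N ((attnBlock N Θ X).col t))) ≠ ⊤ ∧
    (⨆ t, xiAdd (X.col t) ((attn Θ (colMap N X)).col t)) ≠ ⊤ ∧ xiAttn Θ (colMap N X) ≠ ⊤ := by
  have hM := le_iSup_of_le (f := fun t => xiAdd ((attnBlock N Θ X).col t)
    (mlp Θ (N ((attnBlock N Θ X).col t))) * xiMlp Θ (N ((attnBlock N Θ X).col t))) t
    (one_le_mul (one_le_xiAdd (hmlp t k)) (one_le_xiMlp (hmlp t k)))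
  have hF := le_iSup_of_le (f := fun t => xiAdd (X.col t) ((attn Θ (colMap N X)).col t)) t
    (one_le_xiAdd (hattn t k))
  obtain ⟨hMF, hA⟩ := ne_top_of_mul_ne_top h (one_le_mul hM hF) (one_le_xiAttn (hattn t k))
  obtain ⟨h1, h2⟩ := ne_top_of_mul_ne_top hMF hM hF
  exact ⟨h1, h2, hA⟩

/-- A zero output entry with a non-zero perceptron summand would make `xiAdd` infinite.
Non-vanishing turns slack in the relative constant into strict slack in the absolute error. -/
theorem block_ne_zero {d D n : ℕ} {N : (Fin d → ℝ) → Fin d → ℝ} {Θ : Config d D}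
    {X : Matrix (Fin d) (Fin n) ℝ} (hattn : ∀ t, Generic ((attn Θ (colMap N X)).col t))
    (hmlp : ∀ t, Generic (mlp Θ (N ((attnBlock N Θ X).col t)))) (h : blockXi N Θ X ≠ ⊤)
    (k : Fin d) (t : Fin n) : block N Θ X k t ≠ 0 := by
  intro h0
  obtain ⟨hM, -⟩ := ne_top_of_mul_ne_top
    (ne_top_of_le_ne_top (ne_top_of_blockXi_ne_top k t hattn hmlp h).1 (le_iSup (fun t =>
      xiAdd ((attnBlock N Θ X).col t) (mlp Θ (N ((attnBlock N Θ X).col t))) *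
        xiMlp Θ (N ((attnBlock N Θ X).col t))) t))
    (one_le_xiAdd (hmlp t k)) (one_le_xiMlp (hmlp t k))
  have h1 := xiAdd_spec hM k
  have h2 : (attnBlock N Θ X).col t k + mlp Θ (N ((attnBlock N Θ X).col t)) k = 0 := h0
  rw [h2, abs_zero, mul_zero] at h1
  linarith [abs_pos.2 (hmlp t k), abs_nonneg ((attnBlock N Θ X).col t k)]

theorem one_le_toReal {c : ℝ≥0∞} (h : 1 ≤ c) (hc : c ≠ ⊤) : 1 ≤ c.toReal := by
  simpa using ENNReal.toReal_mono hc h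

variable {ι : Type*} {l : Filter ι} {u : ι → ℝ} {A : ∀ i, FloatArith (u i)}

/-! ### Error of one block -/

namespace Approx

theorem flAttnBlock {d D n : ℕ} (hd : 0 < d) {s : ι → ℝ} {Θ : Config d D}
    (hW : (Θ.Wkᵀ * Θ.Wq).det ≠ 0)
    (hs : Approx A l s √(d : ℝ) (1 * |√(d : ℝ)|)) (hΘ : ∀ᶠ i in l, Θ.IsFloat (A i))
    {Nh : ι → (Fin d → ℝ) → Fin d → ℝ} {N : (Fin d → ℝ) → Fin d → ℝ}
    {Xh : ι → Matrix (Fin d) (Fin n) ℝ} {X : Matrix (Fin d) (Fin n) ℝ} {ε ε' ξ ξ' : ℝ}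
    (hX : ∀ k t, Approx A l (fun i => Xh i k t) (X k t) (ε * |X k t|)) (hε' : 0 ≤ ε')
    (hεε' : ε ≤ ε') (hN : ∀ k t, Approx A l (fun i => Nh i ((Xh i).col t) k) (N (X.col t) k)
      (ε' * |N (X.col t) k|))
    (hn : ∀ t, ‖WithLp.toLp 2 (N (X.col t))‖ = √(d : ℝ))
    (hξ : 1 ≤ ξ) (hξ' : 1 ≤ ξ')
    (hadd : ∀ k t, |X k t| + |attn Θ (colMap N X) k t| ≤ ξ * |attnBlock N Θ X k t|)
    (hattn : ∀ k t, attnMajorant Θ (colMap N X) k t ≤ ξ' * |attn Θ (colMap N X) k t|)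
    (hu : Tendsto u l (𝓝[>] 0)) (k : Fin d) (t : Fin n) :
    Approx A l (fun i => flAttnBlock (A i) (s i) (Nh i) Θ (Xh i) k t) (attnBlock N Θ X k t)
      (ξ * ξ' * keyQueryFactor Θ * (ε' + 2 * n + 3 / 2 * d + 3) * |attnBlock N Θ X k t|) := by
  have hA := flAttn (Rh := fun i => colMap (Nh i) (Xh i)) (R := colMap N X) hd hW hs hΘ hN hε' hn
    hu k t
  have hK := one_le_keyQueryFactor hd Θ hW
  have hξK : 1 ≤ ξ' * keyQueryFactor Θ := one_le_mul_of_one_le_of_one_le hξ' hK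
  have hc : 0 ≤ ε' + 2 * n + 3 / 2 * d + 2 := by positivity
  have h := fadd_rel (ξ := ξ) (b := ξ' * keyQueryFactor Θ * (ε' + 2 * n + 3 / 2 * d + 2))
    (hX k t) (hA.mono hu ?_) ?_ (by positivity) (hadd k t) hξ hu
  · refine h.mono hu (mul_le_mul_of_nonneg_right ?_ (abs_nonneg _))
    calc ξ * (ξ' * keyQueryFactor Θ * (ε' + 2 * n + 3 / 2 * d + 2) + 1)
        ≤ ξ * (ξ' * keyQueryFactor Θ * (ε' + 2 * n + 3 / 2 * d + 2) + ξ' * keyQueryFactor Θ) := by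
          gcongr
      _ = _ := by ring
  · calc keyQueryFactor Θ * (ε' + 2 * n + 3 / 2 * d + 2) * attnMajorant Θ (colMap N X) k t
        ≤ keyQueryFactor Θ * (ε' + 2 * n + 3 / 2 * d + 2) *
            (ξ' * |attn Θ (colMap N X) k t|) := by
          gcongr
          exact hattn k t
      _ = _ := by ring
  · have : ε ≤ ε' + 2 * n + 3 / 2 * d + 2 := by
      have h1 := (Nat.cast_nonneg n : (0 : ℝ) ≤ n)
      have h2 := (Nat.cast_nonneg d : (0 : ℝ) ≤ d)
      linarith
    exact this.trans (le_mul_of_one_le_left hc hξK)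

/-- Error of a block, for a normalization whose relative error on the columns concerned is
`p * ε + q` at relative input error `ε`. -/
theorem flBlock {d D n : ℕ} (hd : 0 < d) {s : ι → ℝ} {Θ : Config d D}
    (hW : (Θ.Wkᵀ * Θ.Wq).det ≠ 0)
    (hs : Approx A l s √(d : ℝ) (1 * |√(d : ℝ)|)) (hΘ : ∀ᶠ i in l, Θ.IsFloat (A i))
    {Nh : ι → (Fin d → ℝ) → Fin d → ℝ} {N : (Fin d → ℝ) → Fin d → ℝ}
    {Xh : ι → Matrix (Fin d) (Fin n) ℝ} {X : Matrix (Fin d) (Fin n) ℝ} {ε p q p' q' : ℝ}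
    (hX : ∀ k t, Approx A l (fun i => Xh i k t) (X k t) (ε * |X k t|)) (hε : 0 ≤ ε)
    (hp : 1 ≤ p) (hq : 0 ≤ q) (hp' : 1 ≤ p') (hq' : 0 ≤ q')
    (hNX : ∀ t (xh : ι → Fin d → ℝ) (δ : ℝ), 0 ≤ δ →
      (∀ k, Approx A l (fun i => xh i k) (X.col t k) (δ * |X.col t k|)) →
      ∀ k, Approx A l (fun i => Nh i (xh i) k) (N (X.col t) k) ((p * δ + q) * |N (X.col t) k|))
    (hNY : ∀ t (yh : ι → Fin d → ℝ) (δ : ℝ), 0 ≤ δ →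
      (∀ k, Approx A l (fun i => yh i k) ((attnBlock N Θ X).col t k)
        (δ * |(attnBlock N Θ X).col t k|)) →
      ∀ k, Approx A l (fun i => Nh i (yh i) k) (N ((attnBlock N Θ X).col t) k)
        ((p' * δ + q') * |N ((attnBlock N Θ X).col t) k|))
    (hn : ∀ t, ‖WithLp.toLp 2 (N (X.col t))‖ = √(d : ℝ))
    (hattn : ∀ t, Generic ((attn Θ (colMap N X)).col t))
    (hmlp : ∀ t, Generic (mlp Θ (N ((attnBlock N Θ X).col t))))
    (haff : ∀ t, Generic (affine₁ Θ (N ((attnBlock N Θ X).col t))))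
    (hξ : blockXi N Θ X ≠ ⊤) (hu : Tendsto u l (𝓝[>] 0)) (k : Fin d) (t : Fin n) :
    Approx A l (fun i => flBlock (A i) (s i) (Nh i) Θ (Xh i) k t) (block N Θ X k t)
      ((blockXi N Θ X).toReal * keyQueryFactor Θ *
        (p' * (p * ε + q + 2 * n + 3 / 2 * d + 3) + q' + d + D + 3) * |block N Θ X k t|) := by
  set Y := attnBlock N Θ X with hY
  have hterm : ∀ t, 1 ≤ xiAdd (Y.col t) (mlp Θ (N (Y.col t))) * xiMlp Θ (N (Y.col t)) := fun t =>
    one_le_mul (one_le_xiAdd (hmlp t k)) (one_le_xiMlp (hmlp t k))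
  have hF1 : ∀ t, 1 ≤ xiAdd (X.col t) ((attn Θ (colMap N X)).col t) := fun t =>
    one_le_xiAdd (hattn t k)
  have hA1 : 1 ≤ xiAttn Θ (colMap N X) := one_le_xiAttn (hattn t k)
  obtain ⟨hM, hF, hA⟩ := ne_top_of_blockXi_ne_top k t hattn hmlp hξ
  have hB : (blockXi N Θ X).toReal =
      (⨆ t, xiAdd (Y.col t) (mlp Θ (N (Y.col t))) * xiMlp Θ (N (Y.col t))).toReal *
      (⨆ t, xiAdd (X.col t) ((attn Θ (colMap N X)).col t)).toReal *
      (xiAttn Θ (colMap N X)).toReal := by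
    rw [blockXi, ENNReal.toReal_mul, ENNReal.toReal_mul]
  have hF1' := one_le_toReal (le_iSup_of_le t (hF1 t)) hF
  have hA1' := one_le_toReal hA1 hA
  have hadd : ∀ k t, |X k t| + |attn Θ (colMap N X) k t| ≤
      (⨆ t, xiAdd (X.col t) ((attn Θ (colMap N X)).col t)).toReal * |Y k t| := fun k t => by
    have hle := le_iSup (fun t => xiAdd (X.col t) ((attn Θ (colMap N X)).col t)) t
    exact (xiAdd_spec (ne_top_of_le_ne_top hF hle) k).trans
      (mul_le_mul_of_nonneg_right (ENNReal.toReal_mono hF hle) (abs_nonneg _))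
  obtain ⟨hM1, hM2⟩ := ne_top_of_mul_ne_top
    (ne_top_of_le_ne_top hM (le_iSup (fun t => xiAdd (Y.col t) (mlp Θ (N (Y.col t))) *
      xiMlp Θ (N (Y.col t))) t)) (one_le_xiAdd (hmlp t k)) (one_le_xiMlp (hmlp t k))
  have hMle := ENNReal.toReal_mono hM (le_iSup (fun t => xiAdd (Y.col t) (mlp Θ (N (Y.col t))) *
      xiMlp Θ (N (Y.col t))) t)
  rw [ENNReal.toReal_mul] at hMle
  have hξ1 := one_le_toReal (one_le_xiAdd (x := Y.col t) (hmlp t k)) hM1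
  have hξ2 := one_le_toReal (one_le_xiMlp (hmlp t k)) hM2
  have hε' : 0 ≤ p * ε + q := by positivity
  have hYa := flAttnBlock (Nh := Nh) (N := N) (ε' := p * ε + q) hd hW hs hΘ hX hε'
    (by nlinarith) (fun k t => hNX t _ ε hε (fun k => hX k t) k) hn hF1' hA1' hadd
    (xiAttn_spec hA) hu
  have hK := one_le_keyQueryFactor hd Θ hW
  rw [hB]
  generalize (⨆ t, xiAdd (Y.col t) (mlp Θ (N (Y.col t))) * xiMlp Θ (N (Y.col t))).toReal = M at *
  generalize (⨆ t, xiAdd (X.col t) ((attn Θ (colMap N X)).col t)).toReal = F at *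
  generalize (xiAttn Θ (colMap N X)).toReal = a at *
  generalize keyQueryFactor Θ = K at *
  have hc : 0 ≤ p * ε + q + 2 * n + 3 / 2 * d + 3 := by positivity
  -- `ρ` is the relative error after the attention sub-block.
  set ρ := F * a * K * (p * ε + q + 2 * n + 3 / 2 * d + 3) with hρ
  have hρ0 : 0 ≤ ρ := by positivity
  have hmlp' := flMlp hΘ (hNY t _ ρ hρ0 fun k => hYa k t) (by positivity) (haff t) hu k
  have hb : 0 ≤ p' * ρ + q' + d + D + 2 := by positivity
  have hρb : ρ ≤ p' * ρ + q' + d + D + 2 := by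
    have h1 := (Nat.cast_nonneg D : (0 : ℝ) ≤ D)
    have h2 := (Nat.cast_nonneg d : (0 : ℝ) ≤ d)
    nlinarith
  set x₁ := (xiAdd (Y.col t) (mlp Θ (N (Y.col t)))).toReal
  set x₂ := (xiMlp Θ (N (Y.col t))).toReal
  have h := fadd_rel (ξ := x₁) (b := x₂ * (p' * ρ + q' + d + D + 2)) (hYa k t)
    (hmlp'.mono hu ?_) (hρb.trans (le_mul_of_one_le_left hb hξ2)) (by positivity)
    (xiAdd_spec hM1 k) hξ1 hu
  · refine h.mono hu (mul_le_mul_of_nonneg_right ?_ (abs_nonneg _))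
    -- The attention factor `F * a * K` already sits in `ρ`; being at least 1, it can also be put on
    -- the remaining terms and pulled out of the whole bound.
    have hFaK : 1 ≤ F * a * K :=
      one_le_mul_of_one_le_of_one_le (one_le_mul_of_one_le_of_one_le hF1' hA1') hK
    have hM0 : 0 ≤ M := le_trans (by positivity) hMle
    calc x₁ * (x₂ * (p' * ρ + q' + d + D + 2) + 1)
        ≤ x₁ * (x₂ * (p' * ρ + q' + d + D + 2) + x₂) := by gcongr
      _ = (x₁ * x₂) * (p' * ρ + (q' + d + D + 3)) := by ring
      _ ≤ M * (p' * ρ + (F * a * K) * (q' + d + D + 3)) := by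
        gcongr
        exact le_mul_of_one_le_left (by positivity) hFaK
      _ = _ := by
        rw [hρ]
        ring
  · calc (p' * ρ + q' + d + D + 2) * mlpMajorant Θ (N (Y.col t)) k
        ≤ (p' * ρ + q' + d + D + 2) * (x₂ * |mlp Θ (N (Y.col t)) k|) := by
          gcongr
          exact xiMlp_spec hM2 k
      _ = _ := by ring

end Approx

end

/-! ### Composition of layers -/

theorem Approx.deep {ι : Type*} {l : Filter ι} {u : ι → ℝ} {A : ∀ i, FloatArith (u i)}
    {C : Type*} {d n : ℕ} {step : C → Matrix (Fin d) (Fin n) ℝ → Matrix (Fin d) (Fin n) ℝ}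
    {steph : ι → C → Matrix (Fin d) (Fin n) ℝ → Matrix (Fin d) (Fin n) ℝ} {b κ : ℝ}
    (hb : 0 ≤ b) (hκ : 0 ≤ κ) (hu : Tendsto u l (𝓝[>] 0)) {X : Matrix (Fin d) (Fin n) ℝ}
    (hX : ∀ k t, ∀ᶠ i in l, X k t ∈ (A i).F) {L : ℕ} {Θ : Fin L → C} {c : Fin L → ℝ}
    (hc : ∀ m, 1 ≤ c m)
    (hstep : ∀ m (Xh : ι → Matrix (Fin d) (Fin n) ℝ) (ε : ℝ), 0 ≤ ε →
      (∀ k t, Approx A l (fun i => Xh i k t) (layerInput step Θ X m k t)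
        (ε * |layerInput step Θ X m k t|)) →
      ∀ k t, Approx A l (fun i => steph i (Θ m) (Xh i) k t)
        (step (Θ m) (layerInput step Θ X m) k t)
        (c m * (b * ε + κ) * |step (Θ m) (layerInput step Θ X m) k t|)) (k : Fin d) (t : Fin n) :
    Approx A l (fun i => deep (steph i) L Θ X k t) (deep step L Θ X k t)
      ((∏ m, c m) * κ * (∑ j ∈ Finset.range L, b ^ j) * |deep step L Θ X k t|) := by
  induction L generalizing k t with
  | zero => simpa [Transformer.deep] using const (hX k t)
  | succ L ih =>
    have hP : 1 ≤ ∏ m : Fin L, c m.castSucc :=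
      Finset.one_le_prod (s := Finset.univ) fun m _ => hc m.castSucc
    have hS : 0 ≤ ∑ j ∈ Finset.range L, b ^ j := Finset.sum_nonneg fun j _ => pow_nonneg hb j
    have h := hstep (Fin.last L) _ _ (by positivity)
      (ih (fun m => hc m.castSucc) fun m => hstep m.castSucc) k t
    refine h.mono hu (mul_le_mul_of_nonneg_right ?_ (abs_nonneg _))
    rw [Fin.prod_univ_castSucc, geom_sum_succ]
    have hlast := zero_le_one.trans (hc (Fin.last L))
    -- The product of the earlier factors is at least 1, so it may be attached to the fresh error
    -- `κ`; Horner's form of the geometric sum then closes the induction.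
    calc c (Fin.last L) *
          (b * ((∏ m : Fin L, c m.castSucc) * κ * ∑ j ∈ Finset.range L, b ^ j) + κ)
        ≤ c (Fin.last L) * (b * ((∏ m : Fin L, c m.castSucc) * κ * ∑ j ∈ Finset.range L, b ^ j) +
            (∏ m : Fin L, c m.castSucc) * κ) := by
          gcongr
          exact le_mul_of_one_le_left hκ hP
      _ = _ := by ring

/-! ### From the filter to thresholds uniform in the arithmetic -/

/-- A unit roundoff, an arithmetic with this unit roundoff and a number representing `√d`. -/
abbrev Machine : Type := Σ u : ℝ, FloatArith u × ℝ

/-- Small unit roundoffs, with arithmetics in which the data are floating-point numbers. -/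
def smallRoundoff {d D n L : ℕ} (Θ : Fin L → Config d D) (X : Matrix (Fin d) (Fin n) ℝ) :
    Filter Machine :=
  comap Sigma.fst (𝓝[>] 0) ⊓ 𝓟 {i | IsFloatData i.2.1 i.2.2 Θ X}

section

variable {d D n L : ℕ} {Θ : Fin L → Config d D} {X : Matrix (Fin d) (Fin n) ℝ}

theorem tendsto_smallRoundoff : Tendsto Sigma.fst (smallRoundoff Θ X) (𝓝[>] 0) :=
  tendsto_comap.mono_left inf_le_left

theorem eventually_isFloatData :
    ∀ᶠ i in smallRoundoff Θ X, IsFloatData i.2.1 i.2.2 Θ X :=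
  mem_inf_of_right (mem_principal_self _)

theorem exists_of_eventually_smallRoundoff {P : Machine → Prop}
    (h : ∀ᶠ i in smallRoundoff Θ X, P i) :
    ∃ u₀ > 0, ∀ u : ℝ, 0 < u → u ≤ u₀ → ∀ (𝔸 : FloatArith u) (s : ℝ), IsFloatData 𝔸 s Θ X →
      P ⟨u, 𝔸, s⟩ := by
  rw [smallRoundoff, eventually_inf_principal, eventually_comap, eventually_nhdsWithin_iff,
    Metric.eventually_nhds_iff] at h
  obtain ⟨ε, hε, h⟩ := h
  refine ⟨ε / 2, by positivity, fun u hu hu' 𝔸 s hd => h ?_ hu ⟨u, 𝔸, s⟩ rfl hd⟩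
  rw [Real.dist_0_eq_abs, abs_of_pos hu]
  linarith

theorem approx_sqrt : Approx (fun i : Machine => i.2.1) (smallRoundoff Θ X) (fun i => i.2.2)
    √(d : ℝ) (1 * |√(d : ℝ)|) := by
  refine ⟨eventually_isFloatData.mono fun i h => h.2.2.2.1, .of_le ?_⟩
  filter_upwards [eventually_isFloatData] with i h
  rw [one_mul, abs_of_nonneg (Real.sqrt_nonneg _), mul_comm]
  exact h.2.2.2.2

theorem relDist_deep_le {step : Config d D → Matrix (Fin d) (Fin n) ℝ → Matrix (Fin d) (Fin n) ℝ}
    {steph : Machine → Config d D → Matrix (Fin d) (Fin n) ℝ → Matrix (Fin d) (Fin n) ℝ}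
    {b κ : ℝ} (hb : 1 < b) (hκ : 0 < κ) {C : Fin L → ℝ≥0∞} (hC : ∀ m, 1 ≤ C m)
    (hstep : ∀ m (Xh : Machine → Matrix (Fin d) (Fin n) ℝ) (ε : ℝ), C m ≠ ⊤ → 0 ≤ ε →
      (∀ k t, Approx (fun i : Machine => i.2.1) (smallRoundoff Θ X) (fun i => Xh i k t)
        (layerInput step Θ X m k t) (ε * |layerInput step Θ X m k t|)) →
      ∀ k t, Approx (fun i : Machine => i.2.1) (smallRoundoff Θ X)
        (fun i => steph i (Θ m) (Xh i) k t) (step (Θ m) (layerInput step Θ X m) k t)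
        ((C m).toReal * (b * ε + κ) * |step (Θ m) (layerInput step Θ X m) k t|))
    (hne : ∀ m, C m ≠ ⊤ → ∀ k t, step (Θ m) (layerInput step Θ X m) k t ≠ 0) :
    ∃ u₀ > 0, ∀ u : ℝ, 0 < u → u ≤ u₀ → ∀ (𝔸 : FloatArith u) (s : ℝ), IsFloatData 𝔸 s Θ X →
      relDist (deep (steph ⟨u, 𝔸, s⟩) L Θ X) (deep step L Θ X) ≤
        (∏ m, C m) * ENNReal.ofReal (b ^ L / (b - 1) * κ * u) := by
  have hb' : 0 < b - 1 := sub_pos.2 hb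
  have hb0 : 0 < b := zero_lt_one.trans hb
  rcases L with _ | L
  -- Without layers nothing is computed and the distance is `0`. This case is separate because the
  -- main argument needs a last layer to know that the output is non-zero.
  · exact ⟨1, one_pos, fun u _ _ 𝔸 s _ => by simp [relDist, deep, absRatio]⟩
  by_cases htop : ∃ m, C m = ⊤
  · obtain ⟨m, hm⟩ := htop
    refine ⟨1, one_pos, fun u hu _ 𝔸 s _ => ?_⟩
    have h0 : ∀ j ∈ Finset.univ, C j ≠ 0 := fun j _ => (zero_lt_one.trans_le (hC j)).ne'
    have hprod : ∏ j, C j = ⊤ := WithTop.prod_eq_top (Finset.mem_univ m) hm h0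
    rw [hprod, ENNReal.top_mul (ENNReal.ofReal_pos.2 (by positivity)).ne']
    exact le_top
  push Not at htop
  have hc : ∀ m, 1 ≤ (C m).toReal := fun m => one_le_toReal (hC m) (htop m)
  have hP : 1 ≤ ∏ m, (C m).toReal := Finset.one_le_prod (s := Finset.univ) fun m _ => hc m
  have hdeep := Approx.deep hb0.le hκ.le tendsto_smallRoundoff
    (fun k t => eventually_isFloatData.mono fun i h => h.1 k t) hc
    (fun m Xh ε => hstep m Xh ε (htop m))
  obtain ⟨u₀, hu₀, h⟩ := exists_of_eventually_smallRoundoff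
    (P := fun i => ∀ k t, |deep (steph i) (L + 1) Θ X k t - deep step (L + 1) Θ X k t| ≤
      (∏ m, (C m).toReal) * (b ^ (L + 1) / (b - 1) * κ * i.1) * |deep step (L + 1) Θ X k t|) (by
    refine eventually_all.2 fun k => eventually_all.2 fun t => ?_
    have hpos : 0 < |deep step (L + 1) Θ X k t| :=
      abs_pos.2 (hne (Fin.last L) (htop (Fin.last L)) k t)
    refine ((hdeep k t).2.eventually_le tendsto_smallRoundoff
      (b := (∏ m, (C m).toReal) * (b ^ (L + 1) / (b - 1) * κ) *
        |deep step (L + 1) Θ X k t|) ?_).mono fun i hi => hi.trans (le_of_eq (by ring))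
    refine mul_lt_mul_of_pos_right ?_ hpos
    rw [mul_assoc, mul_comm κ]
    refine mul_lt_mul_of_pos_left (mul_lt_mul_of_pos_right ?_ hκ) (zero_lt_one.trans_le hP)
    -- The strict slack: `(b ^ (L + 1) - 1) / (b - 1) < b ^ (L + 1) / (b - 1)`.
    rw [geom_sum_eq hb.ne']
    gcongr
    linarith)
  refine ⟨u₀, hu₀, fun u hu hu' 𝔸 s hs => ?_⟩
  refine (relDist_le (by positivity) (h u hu hu' 𝔸 s hs)).trans (le_of_eq ?_)
  rw [ENNReal.ofReal_mul (by positivity),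
    ENNReal.ofReal_prod_of_nonneg fun _ _ => ENNReal.toReal_nonneg]
  simp only [ENNReal.ofReal_toReal (htop _)]

theorem gamma_nonneg {u : ℝ} {k : ℕ} (hu : 0 ≤ u) (hk : k * u < 1) : 0 ≤ gamma u k :=
  div_nonneg (by positivity) (by linarith)

/-- The conclusion is free of `u`: admissibility at one roundoff serves all others. -/
theorem AffineGeneric.generic {u α : ℝ} {Θ : Config d D} {x : Fin d → ℝ}
    (h : AffineGeneric u α Θ x) (hu : 0 ≤ u) (hdu : d * u < 1) (hα : 1 ≤ α) :
    Generic (affine₁ Θ x) := fun k => by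
  have hγ := gamma_nonneg hu hdu
  have hS : 0 ≤ ∑ j, |Θ.A₁ k j| * |x j| + |Θ.b₁ k| := by positivity
  exact abs_pos.1 (lt_of_le_of_lt (by positivity) (h k))

theorem CentrGeneric.minAbs_pos {u α : ℝ} {x : Fin d → ℝ} (h : CentrGeneric u α x) (hu : 0 ≤ u)
    (hdu : d * u < 1) (hα : 1 ≤ α) : 0 < minAbs (centr x) := by
  have hγ := gamma_nonneg hu hdu
  exact lt_of_le_of_lt (by positivity) h

theorem minAbs_le (x : Fin d → ℝ) (k : Fin d) : minAbs x ≤ |x k| :=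
  ciInf_le (Set.finite_range _).bddBelow k

theorem norm_le_centrRatio_mul (h : centrRatio X ≠ ⊤) (k : Fin d) (t : Fin n)
    (h0 : 0 < minAbs (centr (X.col t))) :
    ‖X.col t‖ ≤ (centrRatio X).toReal * |centr (X.col t) k| := by
  have h1 := abs_le_of_absRatio_le
    (le_iSup (fun t => absRatio ‖X.col t‖ (minAbs (centr (X.col t)))) t) h
  rw [abs_of_nonneg (norm_nonneg _), abs_of_pos h0] at h1
  exact h1.trans (mul_le_mul_of_nonneg_left (minAbs_le _ k) ENNReal.toReal_nonneg)

/-! ### The two architectures -/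

theorem relDist_rms_le (hd : 2 ≤ d) (hW : ∀ l, ((Θ l).Wkᵀ * (Θ l).Wq).det ≠ 0) {u' : ℝ}
    (hu' : 0 ≤ u') (hdu' : d * u' < 1)
    (h : ∀ l, RmsAdmissible u' (Θ l) (layerInput (block rmsNorm) Θ X l)) :
    ∃ u₀ > 0, ∀ u : ℝ, 0 < u → u ≤ u₀ → ∀ (𝔸 : FloatArith u) (s : ℝ), IsFloatData 𝔸 s Θ X →
      relDist (deep (flBlock 𝔸 s (flRmsNorm 𝔸 s)) L Θ X) (deep (block rmsNorm) L Θ X) ≤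
        (∏ l, blockXi rmsNorm (Θ l) (layerInput (block rmsNorm) Θ X l) *
            ENNReal.ofReal (keyQueryFactor (Θ l))) *
          ENNReal.ofReal ((9 : ℝ) ^ L / 8 * (6 * n + 23 * d + D) * u) := by
  rcases isEmpty_or_nonempty (Fin n) with hn | ⟨⟨t₀⟩⟩
  · exact ⟨1, one_pos, fun u _ _ 𝔸 s _ => by simp [relDist]⟩
  have hd0 : 0 < d := by omega
  have hdR : (2 : ℝ) ≤ d := by exact_mod_cast hd
  have hK := fun l => one_le_keyQueryFactor hd0 (Θ l) (hW l)
  have hC1 := fun l => one_le_blockXi (N := rmsNorm) ⟨0, hd0⟩ t₀ ((h l).2.1 t₀ _)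
    (((h l).2.2 t₀).2.1 _)
  have hK1 := fun l => ENNReal.one_le_ofReal.2 (hK l)
  have key := relDist_deep_le (Θ := Θ) (X := X) (step := block rmsNorm)
    (steph := fun i => flBlock i.2.1 i.2.2 (flRmsNorm i.2.1 i.2.2))
    (b := 9) (κ := 6 * n + 23 * d + D) (by norm_num) (by positivity)
    (C := fun l => blockXi rmsNorm (Θ l) (layerInput (block rmsNorm) Θ X l) *
      ENNReal.ofReal (keyQueryFactor (Θ l)))
    (fun l => one_le_mul (hC1 l) (hK1 l)) ?_ ?_
  · norm_num at key ⊢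
    exact key
  · intro m Xh ε hm hε hX k t
    have hξ := (ne_top_of_mul_ne_top hm (hC1 m) (hK1 m)).1
    have hstep := Approx.flBlock (Nh := fun i => flRmsNorm i.2.1 i.2.2) (N := rmsNorm)
      (p := 2) (q := d / 2 + 4) (p' := 2) (q' := d / 2 + 4) hd0 (hW m) approx_sqrt
      (eventually_isFloatData.mono fun i h => h.2.1 m) hX hε (by norm_num) (by positivity)
      (by norm_num) (by positivity)
      (fun t xh δ hδ hx k => by
        simpa only [add_assoc] using Approx.flRmsNorm approx_sqrt hx hδ ((h m).1 t)
          tendsto_smallRoundoff k)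
      (fun t xh δ hδ hx k => by
        simpa only [add_assoc] using Approx.flRmsNorm approx_sqrt hx hδ ((h m).2.2 t).1
          tendsto_smallRoundoff k)
      (fun t => norm_rmsNorm ((h m).1 t)) (h m).2.1 (fun t => ((h m).2.2 t).2.1)
      (fun t => by
        obtain ⟨α, hα, ha⟩ := ((h m).2.2 t).2.2
        exact ha.generic hu' hdu' hα)
      hξ tendsto_smallRoundoff k t
    refine hstep.mono tendsto_smallRoundoff (mul_le_mul_of_nonneg_right ?_ (abs_nonneg _))
    rw [ENNReal.toReal_mul, ENNReal.toReal_ofReal (zero_le_one.trans (hK m))]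
    refine mul_le_mul_of_nonneg_left ?_ (mul_nonneg ENNReal.toReal_nonneg
      (zero_le_one.trans (hK m)))
    -- The block estimate is `4ε + 4n + 11d/2 + D + 21`, and `d ≥ 2` absorbs the constant 21.
    have hn0 := Nat.cast_nonneg (α := ℝ) n
    have hD0 := Nat.cast_nonneg (α := ℝ) D
    linarith
  · intro m hm k t
    exact block_ne_zero (h m).2.1 (fun t => ((h m).2.2 t).2.1)
      (ne_top_of_mul_ne_top hm (hC1 m) (hK1 m)).1 k t

theorem relDist_layer_le (hd : 2 ≤ d) (hW : ∀ l, ((Θ l).Wkᵀ * (Θ l).Wq).det ≠ 0) {u' : ℝ}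
    (hu' : 0 ≤ u') (hdu' : d * u' < 1)
    (h : ∀ l, LayerAdmissible u' (Θ l) (layerInput (block layerNorm) Θ X l)) :
    ∃ u₀ > 0, ∀ u : ℝ, 0 < u → u ≤ u₀ → ∀ (𝔸 : FloatArith u) (s : ℝ), IsFloatData 𝔸 s Θ X →
      relDist (deep (flBlock 𝔸 s (flLayerNorm 𝔸 s)) L Θ X) (deep (block layerNorm) L Θ X) ≤
        (∏ l, blockXi layerNorm (Θ l) (layerInput (block layerNorm) Θ X l) *
            ENNReal.ofReal (keyQueryFactor (Θ l)) *
            (1 + centrRatio (layerInput (block layerNorm) Θ X l)) *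
            (1 + centrRatio
              (attnBlock layerNorm (Θ l) (layerInput (block layerNorm) Θ X l)))) *
          ENNReal.ofReal ((16 : ℝ) ^ L / 15 * (8 * n + 34 * d + D) * u) := by
  rcases isEmpty_or_nonempty (Fin n) with hn | ⟨⟨t₀⟩⟩
  · exact ⟨1, one_pos, fun u _ _ 𝔸 s _ => by simp [relDist]⟩
  have hd0 : 0 < d := by omega
  have hdR : (2 : ℝ) ≤ d := by exact_mod_cast hd
  have hK := fun l => one_le_keyQueryFactor hd0 (Θ l) (hW l)
  have hC1 := fun l => one_le_blockXi (N := layerNorm) ⟨0, hd0⟩ t₀ ((h l).1 t₀ _)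
    (((h l).2.2 t₀).1 _)
  have hK1 := fun l => ENNReal.one_le_ofReal.2 (hK l)
  have hx1 := fun l => le_self_add (a := (1 : ℝ≥0∞))
    (b := centrRatio (layerInput (block layerNorm) Θ X l))
  have hy1 := fun l => le_self_add (a := (1 : ℝ≥0∞))
    (b := centrRatio (attnBlock layerNorm (Θ l) (layerInput (block layerNorm) Θ X l)))
  have hX0 : ∀ l t, 0 < minAbs (centr ((layerInput (block layerNorm) Θ X l).col t)) :=
    fun l t => by
      obtain ⟨α, hα, hc⟩ := (h l).2.1
      exact (hc t).minAbs_pos hu' hdu' hα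
  have hY0 : ∀ l t, 0 < minAbs (centr
      ((attnBlock layerNorm (Θ l) (layerInput (block layerNorm) Θ X l)).col t)) := fun l t => by
    obtain ⟨α, hα, hc, -⟩ := ((h l).2.2 t).2
    exact hc.minAbs_pos hu' hdu' hα
  have hcentr : ∀ x : Fin d → ℝ, 0 < minAbs (centr x) → centr x ≠ 0 := fun x hx h0 => by
    have := hx.trans_le (minAbs_le _ ⟨0, hd0⟩)
    simp [h0] at this
  have hfin := fun l (hl : blockXi layerNorm (Θ l) (layerInput (block layerNorm) Θ X l) *
      ENNReal.ofReal (keyQueryFactor (Θ l)) *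
      (1 + centrRatio (layerInput (block layerNorm) Θ X l)) *
      (1 + centrRatio (attnBlock layerNorm (Θ l) (layerInput (block layerNorm) Θ X l))) ≠ ⊤) =>
    ne_top_of_mul_ne_top hl (one_le_mul (one_le_mul (hC1 l) (hK1 l)) (hx1 l)) (hy1 l)
  have hfin' := fun l hl => ne_top_of_mul_ne_top (hfin l hl).1
    (one_le_mul (hC1 l) (hK1 l)) (hx1 l)
  have hfin'' := fun l hl => ne_top_of_mul_ne_top (hfin' l hl).1 (hC1 l) (hK1 l)
  have key := relDist_deep_le (Θ := Θ) (X := X) (step := block layerNorm)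
    (steph := fun i => flBlock i.2.1 i.2.2 (flLayerNorm i.2.1 i.2.2))
    (b := 16) (κ := 8 * n + 34 * d + D) (by norm_num) (by positivity)
    (C := fun l => blockXi layerNorm (Θ l) (layerInput (block layerNorm) Θ X l) *
      ENNReal.ofReal (keyQueryFactor (Θ l)) *
      (1 + centrRatio (layerInput (block layerNorm) Θ X l)) *
      (1 + centrRatio (attnBlock layerNorm (Θ l) (layerInput (block layerNorm) Θ X l))))
    (fun l => one_le_mul (one_le_mul (one_le_mul (hC1 l) (hK1 l)) (hx1 l)) (hy1 l)) ?_ ?_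
  · norm_num at key ⊢
    exact key
  · intro m Xh ε hm hε hX k t
    have hcX := (ENNReal.add_ne_top.1 (hfin' m hm).2).2
    have hcY := (ENNReal.add_ne_top.1 (hfin m hm).2).2
    have hcX0 := ENNReal.toReal_nonneg
      (a := centrRatio (layerInput (block layerNorm) Θ X m))
    have hcY0 := ENNReal.toReal_nonneg
      (a := centrRatio (attnBlock layerNorm (Θ m) (layerInput (block layerNorm) Θ X m)))
    have hXc := fun k t => norm_le_centrRatio_mul hcX k t (hX0 m t)
    have hYc := fun k t => norm_le_centrRatio_mul hcY k t (hY0 m t)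
    have hcX' := ENNReal.toReal_add ENNReal.one_ne_top hcX
    have hcY' := ENNReal.toReal_add ENNReal.one_ne_top hcY
    rw [ENNReal.toReal_one] at hcX' hcY'
    rw [ENNReal.toReal_mul, ENNReal.toReal_mul, ENNReal.toReal_mul,
      ENNReal.toReal_ofReal (zero_le_one.trans (hK m)), hcX', hcY']
    generalize (centrRatio (layerInput (block layerNorm) Θ X m)).toReal = cX at hcX0 hXc ⊢
    generalize (centrRatio (attnBlock layerNorm (Θ m)
      (layerInput (block layerNorm) Θ X m))).toReal = cY at hcY0 hYc ⊢
    have hstep := Approx.flBlock (Nh := fun i => flLayerNorm i.2.1 i.2.2) (N := layerNorm)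
      (p := 4 * (1 + cX)) (q := 2 * d * cX + d / 2 + 6)
      (p' := 4 * (1 + cY)) (q' := 2 * d * cY + d / 2 + 6) hd0 (hW m) approx_sqrt
      (eventually_isFloatData.mono fun i h => h.2.1 m) hX hε (by linarith) (by positivity)
      (by linarith) (by positivity)
      (fun t xh δ hδ hx k => (Approx.flLayerNorm hd0 approx_sqrt
        (eventually_isFloatData.mono fun i h => h.2.2.1) hx hδ hcX0
        (fun k => hXc k t) (hcentr _ (hX0 m t)) tendsto_smallRoundoff k).mono
          tendsto_smallRoundoff (mul_le_mul_of_nonneg_right (by linarith) (abs_nonneg _)))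
      (fun t xh δ hδ hx k => (Approx.flLayerNorm hd0 approx_sqrt
        (eventually_isFloatData.mono fun i h => h.2.2.1) hx hδ hcY0
        (fun k => hYc k t) (hcentr _ (hY0 m t)) tendsto_smallRoundoff k).mono
          tendsto_smallRoundoff (mul_le_mul_of_nonneg_right (by linarith) (abs_nonneg _)))
      (fun t => by
        rw [layerNorm_eq_rmsNorm_centr]
        exact norm_rmsNorm (hcentr _ (hX0 m t)))
      (h m).1 (fun t => ((h m).2.2 t).1)
      (fun t => by
        obtain ⟨α, hα, -, ha⟩ := ((h m).2.2 t).2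
        exact ha.generic hu' hdu' hα)
      (hfin'' m hm).1 tendsto_smallRoundoff k t
    refine hstep.mono tendsto_smallRoundoff (mul_le_mul_of_nonneg_right ?_ (abs_nonneg _))
    have hn0 := Nat.cast_nonneg (α := ℝ) n
    have hD0 := Nat.cast_nonneg (α := ℝ) D
    have hX1 : 4 * (1 + cX) * ε + (2 * d * cX + d / 2 + 6) + 2 * n + 3 / 2 * d + 3 ≤
        (1 + cX) * (4 * ε + 2 * d + 2 * n + 9) := by
      linear_combination (2 * n + 9) * hcX0
    have hY1 : 2 * d * cY + d / 2 + 6 + d + D + 3 ≤ (1 + cX) * ((1 + cY) * (2 * d + 9 + D)) := by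
      refine le_trans ?_ (le_mul_of_one_le_left (by positivity) (by linarith))
      linear_combination (9 + D : ℝ) * hcY0 + d / 2 * (zero_le_one' ℝ)
    have hsum : 4 * (1 + cY) * (4 * (1 + cX) * ε + (2 * d * cX + d / 2 + 6) + 2 * n +
          3 / 2 * d + 3) + (2 * d * cY + d / 2 + 6) + d + D + 3 ≤
        (1 + cX) * (1 + cY) * (16 * ε + (8 * n + 34 * d + D)) := by
      have h1 := mul_le_mul_of_nonneg_left hX1 (show 0 ≤ 4 * (1 + cY) by positivity)
      -- `hX1` and `hY1` add up to `16ε + 8n + 10d + D + 45`; the gap to `34d` is `24d - 45`,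
      -- positive for `d ≥ 2`.
      have h2 : (0 : ℝ) ≤ (1 + cX) * (1 + cY) * (24 * d - 45) :=
        mul_nonneg (by positivity) (by linarith)
      linarith
    refine (mul_le_mul_of_nonneg_left hsum (mul_nonneg ENNReal.toReal_nonneg
      (zero_le_one.trans (hK m)))).trans (le_of_eq (by ring))
  · intro m hm k t
    exact block_ne_zero (h m).1 (fun t => ((h m).2.2 t).1) (hfin'' m hm).1 k t

end

end Transformer

theorem theorem1 {d D n L : ℕ} (hd : 2 ≤ d) (Θ : Fin L → Config d D)
    (hW : ∀ l, ((Θ l).Wkᵀ * (Θ l).Wq).det ≠ 0) (X : Matrix (Fin d) (Fin n) ℝ) :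
    (∃ u₀ C : ℝ, 0 < u₀ ∧ 0 ≤ C ∧ ∀ u : ℝ, 0 < u → u ≤ u₀ →
      (∀ l, RmsAdmissible u (Θ l) (layerInput (block rmsNorm) Θ X l)) →
      ∀ (𝔸 : FloatArith u) (s : ℝ), IsFloatData 𝔸 s Θ X →
        relDist (deep (flBlock 𝔸 s (flRmsNorm 𝔸 s)) L Θ X) (deep (block rmsNorm) L Θ X) ≤
          (∏ l, blockXi rmsNorm (Θ l) (layerInput (block rmsNorm) Θ X l) *
              ENNReal.ofReal (keyQueryFactor (Θ l))) *
            ENNReal.ofReal ((9 : ℝ) ^ L / 8 * (6 * n + 23 * d + D) * u) +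
          ENNReal.ofReal (C * u ^ 2)) ∧
    (∃ u₀ C : ℝ, 0 < u₀ ∧ 0 ≤ C ∧ ∀ u : ℝ, 0 < u → u ≤ u₀ →
      (∀ l, LayerAdmissible u (Θ l) (layerInput (block layerNorm) Θ X l)) →
      ∀ (𝔸 : FloatArith u) (s : ℝ), IsFloatData 𝔸 s Θ X →
        relDist (deep (flBlock 𝔸 s (flLayerNorm 𝔸 s)) L Θ X) (deep (block layerNorm) L Θ X) ≤
          (∏ l, blockXi layerNorm (Θ l) (layerInput (block layerNorm) Θ X l) *
              ENNReal.ofReal (keyQueryFactor (Θ l)) *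
              (1 + centrRatio (layerInput (block layerNorm) Θ X l)) *
              (1 + centrRatio
                (attnBlock layerNorm (Θ l) (layerInput (block layerNorm) Θ X l)))) *
            ENNReal.ofReal ((16 : ℝ) ^ L / 15 * (8 * n + 34 * d + D) * u) +
          ENNReal.ofReal (C * u ^ 2)) := by
  -- For `u` up to `1 / (2d)` the denominator of `gamma u d` is positive, so the genericity
  -- conditions do force non-vanishing.
  have hu₁ : (0 : ℝ) < 1 / (2 * d) := by positivity
  have hdu : ∀ u : ℝ, u ≤ 1 / (2 * d) → d * u < 1 := fun u hu => by
    have h := mul_le_mul_of_nonneg_left hu (Nat.cast_nonneg (α := ℝ) d)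
    have h' : (d : ℝ) * (1 / (2 * d)) = 1 / 2 := by field_simp
    linarith
  constructor
  -- The threshold must be chosen before `u`. If some roundoff in this range is admissible, its
  -- `u`-free consequences hold for every `u`; if none is, the claim is vacuous below `1 / (2d)`.
  · by_cases h : ∃ u : ℝ, 0 < u ∧ u ≤ 1 / (2 * d) ∧
        ∀ l, RmsAdmissible u (Θ l) (layerInput (block rmsNorm) Θ X l)
    · obtain ⟨u, hu, hu', hadm⟩ := h
      obtain ⟨u₀, hu₀, H⟩ := relDist_rms_le hd hW hu.le (hdu u hu') hadm
      exact ⟨u₀, 0, hu₀, le_rfl, fun v hv hv' _ 𝔸 s hs =>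
        (H v hv hv' 𝔸 s hs).trans le_self_add⟩
    · exact ⟨1 / (2 * d), 0, hu₁, le_rfl, fun v hv hv' hadm => (h ⟨v, hv, hv', hadm⟩).elim⟩
  · by_cases h : ∃ u : ℝ, 0 < u ∧ u ≤ 1 / (2 * d) ∧
        ∀ l, LayerAdmissible u (Θ l) (layerInput (block layerNorm) Θ X l)
    · obtain ⟨u, hu, hu', hadm⟩ := h
      obtain ⟨u₀, hu₀, H⟩ := relDist_layer_le hd hW hu.le (hdu u hu') hadm
      exact ⟨u₀, 0, hu₀, le_rfl, fun v hv hv' _ 𝔸 s hs =>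
        (H v hv hv' 𝔸 s hs).trans le_self_add⟩
    · exact ⟨1 / (2 * d), 0, hu₁, le_rfl, fun v hv hv' hadm => (h ⟨v, hv, hv', hadm⟩).elim⟩
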